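/- Let $\alpha\in(1,2)$ and $\lambda>0$. Let $0<T_1<T_2<\dots$ be the successive arrival times of a homogeneous Poisson process with rate $\lambda$, and let $(F_u)_u$ be a measurable family of probability distributions on $\mathbb R$. Let $R_1,R_2,\dots$ be real random variables (the noises) which, conditionally on $(T_i)_{i\ge1}$, are independent, $R_j=R_j(T_j)$ having distribution $F_{T_j}$. Put $K_m(u)=\int_{\mathbb R}x^m\,F_u(dx)$ for $u>0$, and assume that these moments are finite for $m=1,2,3,4$, that $K_1(u)=0$ for all $u>0$, that $K_2$ and $K_4$ are positive and bounded on $(0,\infty)$, that $\lim_{u\to\infty}K_2(u)=K>0$, and that $K_4(u)/K_2(u)\le\kappa$ for all $u>0$ and some constant $\kappa>0$. Let $$S(t)=\sum_{j\ge1}(\log t-\log T_j)_+^{(\alpha-1)/2}R_j(T_j)\quad(t>0),\qquad S(0)=0,$$ $$\hat S_{\alpha,c}(t)=\frac{S(ct)}{\sqrt{c\,K\lambda\Gamma(\alpha)}},\qquad t\ge0,\ c>0.$$ For real $z\ge0$ and real non-integer $b$, let $\Psi$ be Tricomi's confluent hypergeometric function $$\Psi(a,b;z)=\frac{\Gamma(1-b)}{\Gamma(1+a-b)}\Phi(a,b;z)+\frac{\Gamma(b-1)}{\Gamma(a)}z^{1-b}\,\Phi(1+a-b,2-b;z),\qquad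 \Phi(a,b;z)=\sum_{l\ge0}\frac{(a)_l}{(b)_l}\frac{z^l}{l!},$$ where $(x)_l=x(x+1)\cdots(x+l-1)$, and let $C_\alpha=2^{1-\alpha}\sqrt\pi/\Gamma(\alpha/2)$. Then there exists a centred Gaussian process $B^H_\alpha=(B^H_\alpha(t))_{t\ge0}$ with covariance $$\operatorname{Cov}\big(B^H_\alpha(s),B^H_\alpha(t)\big)=C_\alpha\,(s\wedge t)\,\Psi\!\left(\tfrac{1-\alpha}{2},1-\alpha;\log\tfrac{s\vee t}{s\wedge t}\right)\ (s,t>0),\qquad B^H_\alpha(0)=0\ \text{a.s.}$$ (the Hadamard fractional Brownian motion, unique in law), and $\hat S_{\alpha,c}$ converges to $B^H_\alpha$ in the sense of finite-dimensional distributions as $c\to+\infty$: for all $n\ge1$ and $t_1,\dots,t_n\ge0$, the vector $(\hat S_{\alpha,c}(t_1),\dots,\hat S_{\alpha,c}(t_n))$ converges in distribution to $(B^H_\alpha(t_1),\dots,B^H_\alpha(t_n))$. -/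

import Mathlib

open MeasureTheory ProbabilityTheory Filter Topology
open scoped NNReal ENNReal

noncomputable section

namespace HadamardShotNoise

/-- Kummer's confluent hypergeometric function `Φ(a, b; z) = ∑ₗ (a)ₗ / (b)ₗ · zˡ / l!`
(for `b` not a non-positive integer), with `(c)ₗ = c (c + 1) ⋯ (c + l - 1)`. -/
def kummerPhi (a b z : ℝ) : ℝ :=
  ∑' l : ℕ, (ascPochhammer ℝ l).eval a / (ascPochhammer ℝ l).eval b * (z ^ l / (l.factorial : ℝ))

/-- Tricomi's confluent hypergeometric function `Ψ(a, b; z)` for real `z ≥ 0` and real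
non-integer `b`, expressed through Kummer's function. -/
def tricomiPsi (a b z : ℝ) : ℝ :=
  Real.Gamma (1 - b) / Real.Gamma (1 + a - b) * kummerPhi a b z +
    Real.Gamma (b - 1) / Real.Gamma a * z ^ (1 - b) * kummerPhi (1 + a - b) (2 - b) z

/-- The constant `C_α = 2 ^ (1 - α) √π / Γ(α / 2)`. -/
def constC (α : ℝ) : ℝ := 2 ^ (1 - α) * √Real.pi / Real.Gamma (α / 2)

/-- The covariance of Hadamard fractional Brownian motion,
`C_α (s ∧ t) Ψ((1 - α)/2, 1 - α; log ((s ∨ t) / (s ∧ t)))`; it vanishes if `s` or `t` is `0`. -/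
def hadamardCov (α : ℝ) (s t : ℝ≥0) : ℝ :=
  constC α * min (s : ℝ) (t : ℝ) *
    tricomiPsi ((1 - α) / 2) (1 - α) (Real.log (max (s : ℝ) (t : ℝ) / min (s : ℝ) (t : ℝ)))

/-- `B` is (in law) a Hadamard fractional Brownian motion with parameter `α`: a centred Gaussian
process indexed by `[0, ∞)` with covariance `hadamardCov α`. -/
structure IsHadamardFBM {Ω : Type*} [MeasurableSpace Ω] (α : ℝ) (P : Measure Ω)
    (B : ℝ≥0 → Ω → ℝ) : Prop where
  isGaussianProcess : IsGaussianProcess B P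
  mean_zero : ∀ t, ∫ ω, B t ω ∂P = 0
  covariance_eq : ∀ s t, cov[B s, B t; P] = hadamardCov α s t

/-- The waiting times `T₀, T₁ - T₀, T₂ - T₁, …` of a sequence of epochs `T₀, T₁, T₂, …`. -/
def waitingTime {Ω : Type*} (T : ℕ → Ω → ℝ) : ℕ → Ω → ℝ
  | 0 => T 0
  | j + 1 => fun ω => T (j + 1) ω - T j ω

/-- `T₀, T₁, …` are the successive arrival times of a homogeneous Poisson process on `(0, ∞)` with
rate `r`: the waiting times are independent and exponentially distributed with parameter `r`.
(The epochs are numbered from `0` instead of `1`.) -/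
structure IsPoissonEpochs {Ω : Type*} [MeasurableSpace Ω] (r : ℝ) (T : ℕ → Ω → ℝ)
    (P : Measure Ω) : Prop where
  measurable : ∀ j, Measurable (T j)
  hasLaw : ∀ j, HasLaw (waitingTime T j) (expMeasure r) P
  iIndepFun : iIndepFun (waitingTime T) P

/-- Conditionally on all the epochs `(Tⱼ)ⱼ`, the noises `(Rⱼ)ⱼ` are independent and `Rⱼ` has
distribution `F_{Tⱼ}`: for finitely many Borel sets `Aⱼ`,
`P(Rⱼ ∈ Aⱼ for all j ∈ s | (Tᵢ)ᵢ) = ∏_{j ∈ s} F_{Tⱼ}(Aⱼ)` almost surely. -/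
structure IsNoiseGivenEpochs {Ω : Type*} [MeasurableSpace Ω] (F : Kernel ℝ ℝ)
    (T R : ℕ → Ω → ℝ) (P : Measure Ω) : Prop where
  measurable : ∀ j, Measurable (R j)
  condProb_eq : ∀ (s : Finset ℕ) (A : ℕ → Set ℝ), (∀ j, MeasurableSet (A j)) →
    P⟦⋂ j ∈ s, R j ⁻¹' A j | MeasurableSpace.comap (fun ω j => T j ω) inferInstance⟧
      =ᵐ[P] fun ω => ∏ j ∈ s, (F (T j ω)).real (A j)

/-- The conditional moment `K_m(u) = ∫ xᵐ F_u(dx)`. -/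
def condMoment (F : Kernel ℝ ℝ) (m : ℕ) (u : ℝ) : ℝ := ∫ x, x ^ m ∂(F u)

/-- The response function `g(x) = (log x) ^ β` for `x ≥ 1`, and `g(x) = 0` for `x < 1`. -/
def response (β x : ℝ) : ℝ := (Set.Ici (1 : ℝ)).indicator (fun y => Real.log y ^ β) x

/-- The shot noise `S_β(t) = ∑ⱼ g(t / Tⱼ) Rⱼ`, that is `∑ⱼ (log t - log Tⱼ)₊ ^ β Rⱼ` for `t > 0`,
and `0` for `t = 0`. Almost surely only finitely many terms are non-zero. -/
def shotNoise {Ω : Type*} (β : ℝ) (T R : ℕ → Ω → ℝ) (t : ℝ) (ω : Ω) : ℝ :=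
  ∑' j : ℕ, response β (t / T j ω) * R j ω

/-- The scaled shot noise `S_β(c t) / √(c K r Γ(α))` with `β = (α - 1) / 2` and rate `r`. -/
def scaledShotNoise {Ω : Type*} (α r K : ℝ) (T R : ℕ → Ω → ℝ) (c : ℝ) (t : ℝ≥0) (ω : Ω) : ℝ :=
  shotNoise ((α - 1) / 2) T R (c * (t : ℝ)) ω / √(c * (K * r * Real.Gamma α))

/-- Convergence of the finite-dimensional distributions of the processes `X c` to those of `Y`
as `c → ∞` through the reals. -/
def TendstoFDD {Ω Ω' : Type*} [MeasurableSpace Ω] [MeasurableSpace Ω']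
    (X : ℝ → ℝ≥0 → Ω → ℝ) (P : Measure Ω) [IsProbabilityMeasure P]
    (Y : ℝ≥0 → Ω' → ℝ) (P' : Measure Ω') [IsProbabilityMeasure P'] : Prop :=
  ∀ I : Finset ℝ≥0,
    TendstoInDistribution (fun c ω (t : I) => X c t ω) atTop (fun ω (t : I) => Y t ω)
      (fun _ => P) P'

end HadamardShotNoise

end

/-! The proof goes through characteristic functions. By the Cramér–Wold device it is enough to treat
a linear combination of the scaled noise at finitely many times, which is again a shot noise `∑ⱼ
h(Tⱼ) Rⱼ` whose kernel `h` vanishes beyond some `M`. The characteristic functional of a marked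
Poisson process (`IsNoiseGivenEpochs.integral_cexp_tsum`) gives its characteristic function as `exp
(r ∫ (φ_u(h(u)) - 1) du)`, with `φ_u` the characteristic function of `F_u`. With `η = responseSum`,
`G = K r Γ(α)` and `u = c v`, the exponent is `r ∫ c (φ_{cv}(η(v) / √(cG)) - 1) dv`. The noise is
centred, so the integrand tends to `-η(v)² K / (2G)` and is dominated by a multiple of `η²`. The
limit is `exp (-(∫ η²) / (2 Γ(α)))`: a Gaussian characteristic function with covariance `Γ(α)⁻¹ ∫₀^∞
g(s/v) g(t/v) dv`, where `g` is the response function.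

The characteristic functional comes directly from the exponential waiting times. If `f(u) =
φ_u(h(u))` and `E(s) = exp (r ∫_s^M (f - 1))`, then `𝔼[f(s + W) E(s + W)] = E(s)` for an exponential
`W`, so `∏_{j ≤ n} f(Tⱼ) · E(Tₙ)` has expectation `E(0)` for every `n`. Conditioning on the epochs
puts the noises back in place of `f`, and `E(Tₙ) = 1` once `Tₙ ≥ M`.

The covariance is identified with Tricomi's function as follows. For `s ≤ t`, the substitution `v =
s e⁻ˣ` turns the inner product into `s ∫ e⁻ˣ x^β (x + L)^β dx`, with `β = (α - 1) / 2` and `L = log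
(t / s)`. As a function of `L` this integral solves Kummer's equation; a Wronskian argument
expresses it through the two standard solutions, and its behaviour at `0` fixes their coefficients.
Legendre's duplication formula produces `C_α`.

Since the covariance is an `L²` inner product, the limit process exists: it is the image of the
normalised response functions under an isometry of `L²(0, ∞)` into a space of Gaussian variables. -/

namespace HadamardShotNoise

/-! ### Termwise differentiation of everywhere convergent power series -/

section PowerSeries

variable {c : ℕ → ℝ}

/-- Comparison with the series at `2R`: the factor `l + 1` is absorbed by `2 ^ (l + 1)`. -/
lemma summable_succ_mul_of_summable (h : ∀ z : ℝ, Summable fun l => c l * z ^ l) (z : ℝ) :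
    Summable fun l : ℕ => ((l + 1 : ℕ) : ℝ) * c (l + 1) * z ^ l := by
  set R : ℝ := 1 + |z| with hR
  have hR1 : 1 ≤ R := by simp [hR]
  have hs : Summable fun l : ℕ => |c (l + 1) * (2 * R) ^ (l + 1)| :=
    (summable_nat_add_iff 1).2 (h (2 * R)).abs
  refine Summable.of_norm_bounded hs fun l => ?_
  rw [Real.norm_eq_abs, abs_mul, abs_mul, abs_mul, abs_pow, abs_pow]
  rw [mul_comm |((l + 1 : ℕ) : ℝ)|, mul_assoc]
  refine mul_le_mul_of_nonneg_left ?_ (abs_nonneg _)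
  have h1 : |((l + 1 : ℕ) : ℝ)| ≤ |(2 : ℝ)| ^ (l + 1) := by
    rw [abs_of_nonneg (by positivity), abs_two]
    exact_mod_cast (Nat.lt_two_pow_self (n := l + 1)).le
  have h2 : |z| ^ l ≤ |R| ^ (l + 1) := by
    rw [abs_of_nonneg (by linarith : 0 ≤ R)]
    calc |z| ^ l ≤ R ^ l := by gcongr; linarith [abs_nonneg z]
      _ ≤ R ^ (l + 1) := pow_le_pow_right₀ hR1 (Nat.le_succ l)
  calc _ ≤ |(2 : ℝ)| ^ (l + 1) * |R| ^ (l + 1) := by gcongr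
    _ = |(2 : ℝ) * R| ^ (l + 1) := by rw [abs_mul, mul_pow]
    _ = _ := by rw [abs_mul, mul_pow]

lemma hasDerivAt_tsum_mul_pow (h : ∀ z : ℝ, Summable fun l => c l * z ^ l) (z : ℝ) :
    HasDerivAt (fun z => ∑' l, c l * z ^ l)
      (∑' l : ℕ, ((l + 1 : ℕ) : ℝ) * c (l + 1) * z ^ l) z := by
  set R : ℝ := |z| + 1 with hR
  have hRpos : 0 < R := by positivity
  have hsum := summable_succ_mul_of_summable (c := fun l => |c l|)
    (fun z => by simpa [abs_mul, abs_pow] using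
      (Summable.of_norm (by simpa [abs_mul, abs_pow] using (h |z|).abs) :
        Summable fun l => |c l| * z ^ l)) R
  have hu : Summable fun l : ℕ => (l : ℝ) * |c l| * R ^ (l - 1) := by
    rw [← summable_nat_add_iff 1]
    simpa using hsum
  have key := hasDerivAt_tsum_of_isPreconnected (𝕜 := ℝ) (F := ℝ)
    (g := fun l z => c l * z ^ l) (g' := fun l z => c l * (l * z ^ (l - 1))) (t := Metric.ball 0 R)
    (y₀ := 0) (y := z) hu Metric.isOpen_ball (convex_ball _ _).isPreconnected
    (fun l y _ => (hasDerivAt_pow l y).const_mul (c l)) (fun l y hy => ?_) (by simpa using hRpos)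
    (h 0) (by simp [hR])
  · refine key.congr_deriv ?_
    have hs' : Summable fun l : ℕ => c l * ((l : ℝ) * z ^ (l - 1)) := by
      rw [← summable_nat_add_iff 1]
      refine (summable_succ_mul_of_summable h z).congr fun l => ?_
      simp; ring
    rw [hs'.tsum_eq_zero_add]
    simp only [Nat.cast_zero, zero_mul, mul_zero, zero_add, Nat.add_sub_cancel]
    exact tsum_congr fun l => by ring
  · rw [Real.norm_eq_abs, abs_mul, abs_mul, abs_pow, Nat.abs_cast]
    have : |y| ≤ R := by simpa using (Metric.mem_ball.1 hy).le
    calc |c l| * (l * |y| ^ (l - 1)) ≤ |c l| * (l * R ^ (l - 1)) := by gcongr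
      _ = _ := by ring

lemma mul_tsum_succ_mul_pow (h : ∀ z : ℝ, Summable fun l => c l * z ^ l) (z : ℝ) :
    z * ∑' l : ℕ, ((l + 1 : ℕ) : ℝ) * c (l + 1) * z ^ l = ∑' l : ℕ, (l : ℝ) * c l * z ^ l := by
  have hs' : Summable fun l : ℕ => (l : ℝ) * c l * z ^ l := by
    rw [← summable_nat_add_iff 1]
    refine ((summable_succ_mul_of_summable h z).mul_left z).congr fun l => ?_
    ring
  rw [hs'.tsum_eq_zero_add, ← tsum_mul_left]
  simp only [Nat.cast_zero, zero_mul, zero_add]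
  exact tsum_congr fun l => by ring

end PowerSeries

/-! ### Kummer's function and its differential equation -/

section Kummer

/-- The Taylor coefficients of Kummer's function. -/
noncomputable def kummerCoeff (a b : ℝ) (l : ℕ) : ℝ :=
  (ascPochhammer ℝ l).eval a / (ascPochhammer ℝ l).eval b / (l.factorial : ℝ)

lemma kummerPhi_eq_tsum (a b : ℝ) :
    kummerPhi a b = fun z => ∑' l, kummerCoeff a b l * z ^ l := by
  ext z
  exact tsum_congr fun l => by rw [kummerCoeff]; ring

/-- This recurrence is Kummer's equation read coefficient by coefficient. -/
lemma kummerCoeff_succ {a b : ℝ} (hb : ∀ l : ℕ, b + l ≠ 0) (l : ℕ) :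
    ((l + 1 : ℕ) : ℝ) * ((b + l) * kummerCoeff a b (l + 1)) = (a + l) * kummerCoeff a b l := by
  have h0 : (ascPochhammer ℝ l).eval b ≠ 0 := by
    induction l with
    | zero => simp
    | succ n ih => rw [ascPochhammer_succ_eval]; exact mul_ne_zero ih (hb n)
  have hl := hb l
  have h1 : ((l + 1 : ℕ) : ℝ) ≠ 0 := by positivity
  have h2 : (l.factorial : ℝ) ≠ 0 := by positivity
  simp only [kummerCoeff, ascPochhammer_succ_eval, Nat.factorial_succ]
  push_cast at h1 ⊢
  field_simp

lemma kummerCoeff_zero (a b : ℝ) : kummerCoeff a b 0 = 1 := by simp [kummerCoeff]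

lemma kummerCoeff_succ_eq {a b : ℝ} (hb : ∀ l : ℕ, b + l ≠ 0) (l : ℕ) :
    kummerCoeff a b (l + 1) = (a + l) / ((l + 1) * (b + l)) * kummerCoeff a b l := by
  have h := kummerCoeff_succ (a := a) hb l
  have hl := hb l
  have h1 : (l : ℝ) + 1 ≠ 0 := by positivity
  push_cast at h
  field_simp
  linarith

lemma summable_kummerCoeff {a b : ℝ} (hb : ∀ l : ℕ, b + l ≠ 0) (z : ℝ) :
    Summable fun l => kummerCoeff a b l * z ^ l := by
  have ht : Tendsto (fun l : ℕ => (a + l) / (b + l) * (z / ((l : ℝ) + 1))) atTop (𝓝 0) := by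
    have h1 : Tendsto (fun l : ℕ => (a + l) / (b + l)) atTop (𝓝 1) := by
      have := tendsto_add_mul_div_add_mul_atTop_nhds a b 1 (one_ne_zero (α := ℝ))
      simpa using this
    have h2 : Tendsto (fun l : ℕ => z / ((l : ℝ) + 1)) atTop (𝓝 0) :=
      tendsto_const_nhds.div_atTop (tendsto_atTop_add_const_right _ _ tendsto_natCast_atTop_atTop)
    simpa using h1.mul h2
  refine summable_of_ratio_norm_eventually_le (r := 1 / 2) (by norm_num) ?_
  have := (tendsto_zero_iff_norm_tendsto_zero.1 ht).eventually (ge_mem_nhds (by norm_num : (0:ℝ) < 1 / 2))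
  filter_upwards [this] with l hl
  rw [kummerCoeff_succ_eq hb]
  calc _ = ‖(a + l) / (b + l) * (z / ((l : ℝ) + 1))‖ * ‖kummerCoeff a b l * z ^ l‖ := by
        rw [← norm_mul]; congr 1
        have := hb l
        field_simp
        ring
    _ ≤ _ := by gcongr

/-- All coefficients are nonnegative and the constant term is `1`. The bound keeps the second
solution of Kummer's equation away from `0`, so that it can be divided by. -/
lemma one_le_kummerPhi {a b z : ℝ} (ha : 0 < a) (hb : 0 < b) (hz : 0 ≤ z) :
    1 ≤ kummerPhi a b z := by
  have hb' : ∀ l : ℕ, b + l ≠ 0 := fun l => by positivity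
  have hnn : ∀ l, 0 ≤ kummerCoeff a b l := fun l => by
    induction l with
    | zero => simp [kummerCoeff_zero]
    | succ n ih => rw [kummerCoeff_succ_eq hb']; positivity
  rw [kummerPhi_eq_tsum]
  have := (summable_kummerCoeff (a := a) hb' z).le_tsum 0
    (fun l _ => mul_nonneg (hnn l) (pow_nonneg hz l))
  simpa [kummerCoeff_zero] using this

lemma kummerPhi_zero (a b : ℝ) : kummerPhi a b 0 = 1 := by
  rw [kummerPhi_eq_tsum]
  dsimp only
  rw [tsum_eq_single 0 (fun l hl => by simp [hl])]
  simp [kummerCoeff_zero]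

/-- Kummer's function solves Kummer's differential equation. -/
lemma exists_kummerPhi_ode {a b : ℝ} (hb : ∀ l : ℕ, b + l ≠ 0) :
    ∃ f' f'' : ℝ → ℝ, (∀ z, HasDerivAt (kummerPhi a b) (f' z) z) ∧
      (∀ z, HasDerivAt f' (f'' z) z) ∧ Continuous f'' ∧
      ∀ z, z * f'' z + (b - z) * f' z - a * kummerPhi a b z = 0 := by
  have h0 := summable_kummerCoeff (a := a) hb
  have h1 := summable_succ_mul_of_summable h0
  have h2 := summable_succ_mul_of_summable h1
  refine ⟨_, _, fun z => ?_, hasDerivAt_tsum_mul_pow h1, ?_, fun z => ?_⟩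
  · rw [kummerPhi_eq_tsum]; exact hasDerivAt_tsum_mul_pow h0 z
  · exact continuous_iff_continuousAt.2 fun z => (hasDerivAt_tsum_mul_pow h2 z).continuousAt
  · rw [mul_tsum_succ_mul_pow h1, sub_mul, mul_tsum_succ_mul_pow h0, kummerPhi_eq_tsum,
      ← tsum_mul_left, ← tsum_mul_left]
    have s1 : Summable fun l : ℕ => (l : ℝ) * (((l + 1 : ℕ) : ℝ) * kummerCoeff a b (l + 1)) * z ^ l := by
      rw [← summable_nat_add_iff 1]
      exact ((h2 z).mul_left z).congr fun l => by ring
    have s2 : Summable fun l : ℕ => (l : ℝ) * kummerCoeff a b l * z ^ l := by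
      rw [← summable_nat_add_iff 1]
      exact ((h1 z).mul_left z).congr fun l => by ring
    have s3 := (h1 z).mul_left b
    have s4 := (h0 z).mul_left a
    rw [← s3.tsum_sub s2, ← s1.tsum_add (s3.sub s2), ← (s1.add (s3.sub s2)).tsum_sub s4]
    rw [← tsum_zero (α := ℝ) (β := ℕ)]
    refine tsum_congr fun l => ?_
    linear_combination z ^ l * kummerCoeff_succ (a := a) hb l

end Kummer

/-! ### Tricomi's function as an integral -/

/-- Two solutions of Kummer's equation on `(0, ∞)` are proportional if their Wronskian
vanishes at `0` fast enough. -/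
lemma eq_const_mul_of_kummer_ode {a b : ℝ} {w w' w'' u u' u'' : ℝ → ℝ}
    (hw : ∀ z, 0 < z → HasDerivAt w (w' z) z) (hw' : ∀ z, 0 < z → HasDerivAt w' (w'' z) z)
    (hwode : ∀ z, 0 < z → z * w'' z + (b - z) * w' z - a * w z = 0)
    (hu : ∀ z, 0 < z → HasDerivAt u (u' z) z) (hu' : ∀ z, 0 < z → HasDerivAt u' (u'' z) z)
    (huode : ∀ z, 0 < z → z * u'' z + (b - z) * u' z - a * u z = 0)
    (hupos : ∀ z, 0 < z → u z ≠ 0)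
    (hlim : Tendsto (fun z => z ^ b * (w z * u' z - w' z * u z)) (𝓝[>] 0) (𝓝 0)) :
    ∃ k, ∀ z, 0 < z → w z = k * u z := by
  -- Abel's identity: `z ^ b * exp (-z)` is the integrating factor that makes the Wronskian
  -- constant. The constant is then `0` by the behaviour at `0`, and the quotient `w / u` has zero
  -- derivative.
  set ω : ℝ → ℝ := fun z => z ^ b * Real.exp (-z) * (w z * u' z - w' z * u z) with hω
  have hconst : ∀ (f : ℝ → ℝ), (∀ z, 0 < z → HasDerivAt f 0 z) → ∀ z, 0 < z → f z = f 1 := by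
    intro f hf z hz
    refine (convex_Ioi (0 : ℝ)).is_const_of_fderivWithin_eq_zero (𝕜 := ℝ) ?_ ?_ hz
      (Set.mem_Ioi.2 one_pos)
    · exact fun x hx => (hf x hx).differentiableAt.differentiableWithinAt
    · intro x hx
      have := (hf x hx).hasFDerivAt.hasFDerivWithinAt (s := Set.Ioi 0)
      rw [this.fderivWithin (isOpen_Ioi.uniqueDiffWithinAt hx)]
      ext; simp
  have hωd : ∀ z, 0 < z → HasDerivAt ω 0 z := by
    intro z hz
    have h1 := (Real.hasDerivAt_rpow_const (p := b) (Or.inl hz.ne'))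
    have h2 : HasDerivAt (fun z => Real.exp (-z)) (-Real.exp (-z)) z := by
      simpa using (hasDerivAt_neg z).exp
    have h3 := (((hw z hz).mul (hu' z hz)).sub ((hw' z hz).mul (hu z hz)))
    refine ((h1.mul h2).mul h3).congr_deriv ?_
    have e : z ^ b = z ^ (b - 1) * z := by
      rw [← Real.rpow_add_one hz.ne']; ring_nf
    simp only [Pi.mul_apply, Pi.sub_apply]
    rw [e]
    linear_combination z ^ (b - 1) * Real.exp (-z) * (w z * huode z hz - u z * hwode z hz)
  have hω0 : ∀ z, 0 < z → ω z = 0 := by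
    have hc := hconst ω hωd
    have ht : Tendsto ω (𝓝[>] 0) (𝓝 0) := by
      have h2 : Tendsto (fun z : ℝ => Real.exp (-z)) (𝓝[>] 0) (𝓝 1) := by
        have : Continuous fun z : ℝ => Real.exp (-z) := by fun_prop
        simpa using this.continuousWithinAt (s := Set.Ioi 0) (x := 0) |>.tendsto
      have := h2.mul hlim
      simp only [mul_zero] at this
      refine this.congr fun z => ?_
      simp only [hω]; ring
    have ht' : Tendsto ω (𝓝[>] 0) (𝓝 (ω 1)) :=
      tendsto_const_nhds.congr' (by
        filter_upwards [self_mem_nhdsWithin] with z hz using (hc z hz).symm)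
    intro z hz
    rw [hc z hz, tendsto_nhds_unique ht' ht]
  refine ⟨w 1 / u 1, fun z hz => ?_⟩
  have hq : ∀ z, 0 < z → HasDerivAt (fun z => w z / u z) 0 z := by
    intro z hz
    refine ((hw z hz).div (hu z hz) (hupos z hz)).congr_deriv ?_
    have h := hω0 z hz
    simp only [hω, mul_eq_zero, (Real.rpow_pos_of_pos hz b).ne', (Real.exp_pos _).ne', false_or] at h
    rw [div_eq_zero_iff]; left; linarith
  rw [← hconst _ hq z hz, div_mul_cancel₀ _ (hupos z hz)]

/-- The integral `∫₀^∞ e⁻ˣ xᵖ (x + L)^q dx`. -/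
noncomputable def expRpowIntegral (p q L : ℝ) : ℝ :=
  ∫ x in Set.Ioi (0 : ℝ), Real.exp (-x) * x ^ p * (x + L) ^ q

lemma integrableOn_exp_mul_rpow {p : ℝ} (hp : -1 < p) :
    IntegrableOn (fun x => Real.exp (-x) * x ^ p) (Set.Ioi 0) := by
  simpa using Real.GammaIntegral_convergent (s := p + 1) (by linarith)

lemma integral_exp_mul_rpow {p : ℝ} (hp : -1 < p) :
    ∫ x in Set.Ioi (0 : ℝ), Real.exp (-x) * x ^ p = Real.Gamma (p + 1) := by
  rw [Real.Gamma_eq_integral (by linarith)]; simp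

lemma measurable_expRpow (p q L : ℝ) :
    Measurable fun x : ℝ => Real.exp (-x) * x ^ p * (x + L) ^ q := by fun_prop

lemma expRpow_nonneg {p q L x : ℝ} (hL : 0 ≤ L) (hx : 0 < x) :
    0 ≤ Real.exp (-x) * x ^ p * (x + L) ^ q := by positivity

lemma integrableOn_expRpow {p q L : ℝ} (hp : -1 < p) (hq : q ≤ 1) (hL : 0 < L) :
    IntegrableOn (fun x => Real.exp (-x) * x ^ p * (x + L) ^ q) (Set.Ioi 0) := by
  have hb : IntegrableOn (fun x => L ^ (q - 1) * (Real.exp (-x) * x ^ (p + 1)) +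
      L ^ (q - 1) * L * (Real.exp (-x) * x ^ p)) (Set.Ioi 0) :=
    ((integrableOn_exp_mul_rpow (by linarith)).const_mul _).add
      ((integrableOn_exp_mul_rpow hp).const_mul _)
  refine Integrable.mono' hb (measurable_expRpow p q L).aestronglyMeasurable ?_
  filter_upwards [ae_restrict_mem measurableSet_Ioi] with x hx
  have hx : 0 < x := hx
  rw [Real.norm_of_nonneg (expRpow_nonneg hL.le hx)]
  have h1 : (x + L) ^ q ≤ L ^ (q - 1) * (x + L) := by
    calc (x + L) ^ q = (x + L) ^ (q - 1) * (x + L) := by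
          rw [← Real.rpow_add_one (by positivity)]; ring_nf
      _ ≤ L ^ (q - 1) * (x + L) := by
          gcongr ?_ * _
          exact Real.rpow_le_rpow_of_nonpos hL (by linarith) (by linarith)
  calc _ ≤ Real.exp (-x) * x ^ p * (L ^ (q - 1) * (x + L)) := by gcongr
    _ = _ := by rw [Real.rpow_add_one hx.ne']; ring

lemma hasDerivAt_expRpowIntegral {p q L : ℝ} (hp : -1 < p) (hq : q ≤ 1) (hL : 0 < L) :
    HasDerivAt (expRpowIntegral p q) (q * expRpowIntegral p (q - 1) L) L := by
  have key := hasDerivAt_integral_of_dominated_loc_of_deriv_le (𝕜 := ℝ)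
    (μ := volume.restrict (Set.Ioi (0 : ℝ)))
    (F := fun L x => Real.exp (-x) * x ^ p * (x + L) ^ q)
    (F' := fun L x => Real.exp (-x) * x ^ p * (q * (x + L) ^ (q - 1))) (x₀ := L)
    -- Staying above `L / 2` bounds `(x + y) ^ (q - 1)` uniformly, its exponent being nonpositive.
    (s := Set.Ioi (L / 2)) (bound := fun x => |q| * (L / 2) ^ (q - 1) * (Real.exp (-x) * x ^ p))
    (Ioi_mem_nhds (by linarith))
    (Eventually.of_forall fun L => (measurable_expRpow p q L).aestronglyMeasurable)
    (integrableOn_expRpow hp hq hL) (by fun_prop) ?_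
    ((integrableOn_exp_mul_rpow hp).const_mul _) ?_
  · refine key.2.congr_deriv ?_
    rw [expRpowIntegral, ← integral_const_mul]
    congr 1; ext x; ring
  · filter_upwards [ae_restrict_mem measurableSet_Ioi] with x hx y hy
    have hx : 0 < x := hx
    have hy : L / 2 < y := hy
    rw [norm_mul (Real.exp (-x) * x ^ p), norm_mul q,
      Real.norm_of_nonneg (by positivity : 0 ≤ Real.exp (-x) * x ^ p),
      Real.norm_eq_abs, Real.norm_of_nonneg (Real.rpow_nonneg (by linarith) _)]
    have h1 : (x + y) ^ (q - 1) ≤ (L / 2) ^ (q - 1) :=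
      Real.rpow_le_rpow_of_nonpos (by linarith) (by linarith) (by linarith)
    calc _ ≤ Real.exp (-x) * x ^ p * (|q| * (L / 2) ^ (q - 1)) := by gcongr
      _ = _ := by ring
  · filter_upwards [ae_restrict_mem measurableSet_Ioi] with x hx y hy
    have hx : 0 < x := hx
    have hy : L / 2 < y := hy
    have h1 : HasDerivAt (fun y => x + y) 1 y := by simpa using (hasDerivAt_id y).const_add x
    have := (h1.rpow_const (p := q) (Or.inl (by linarith))).const_mul (Real.exp (-x) * x ^ p)
    simpa using this

lemma tendsto_expRpowIntegral {p q : ℝ} (hp : -1 < p) (hq : q ≤ 1) (hpq : -1 < p + q) :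
    Tendsto (expRpowIntegral p q) (𝓝[>] 0) (𝓝 (Real.Gamma (p + q + 1))) := by
  rw [← integral_exp_mul_rpow hpq]
  refine tendsto_integral_filter_of_dominated_convergence
    (bound := fun x => Real.exp (-x) * x ^ (p + q) + (Real.exp (-x) * x ^ (p + 1) +
      Real.exp (-x) * x ^ p))
    (Eventually.of_forall fun L => (measurable_expRpow p q L).aestronglyMeasurable) ?_
    ((integrableOn_exp_mul_rpow hpq).add ((integrableOn_exp_mul_rpow (by linarith)).add
      (integrableOn_exp_mul_rpow hp))) ?_
  · filter_upwards [Ioo_mem_nhdsGT (zero_lt_one' ℝ)] with L hL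
    filter_upwards [ae_restrict_mem measurableSet_Ioi] with x hx
    have hx : 0 < x := hx
    have hL0 : 0 < L := hL.1
    rw [Real.norm_of_nonneg (expRpow_nonneg hL.1.le hx)]
    -- One bound for both signs of `q`: `x ^ q` serves `q ≤ 0`, and `x + 1` serves `0 ≤ q ≤ 1` with
    -- `L < 1`.
    have h1 : (x + L) ^ q ≤ x ^ q + (x + 1) := by
      rcases le_total q 0 with h | h
      · calc (x + L) ^ q ≤ x ^ q := Real.rpow_le_rpow_of_nonpos hx (by linarith) h
          _ ≤ _ := by linarith
      · have : (x + L) ^ q ≤ (x + 1) ^ q :=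
          Real.rpow_le_rpow (by positivity) (by linarith [hL.2]) h
        have h2 : (x + 1) ^ q ≤ (x + 1) ^ (1 : ℝ) :=
          Real.rpow_le_rpow_of_exponent_le (by linarith) hq
        rw [Real.rpow_one] at h2
        linarith [Real.rpow_nonneg hx.le q]
    calc _ ≤ Real.exp (-x) * x ^ p * (x ^ q + (x + 1)) := by gcongr
      _ = _ := by rw [Real.rpow_add hx, Real.rpow_add_one hx.ne']; ring
  · filter_upwards [ae_restrict_mem measurableSet_Ioi] with x hx
    have hx : 0 < x := hx
    rw [Real.rpow_add hx, ← mul_assoc]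
    refine tendsto_const_nhds.mul ?_
    have : ContinuousAt (fun L => (x + L) ^ q) 0 :=
      ContinuousAt.rpow_const (by fun_prop) (Or.inl (by simpa using hx.ne'))
    have h2 := this.tendsto
    simp only [add_zero] at h2
    exact h2.mono_left nhdsWithin_le_nhds

lemma expRpowIntegral_zero {p q : ℝ} (hpq : -1 < p + q) :
    expRpowIntegral p q 0 = Real.Gamma (p + q + 1) := by
  rw [← integral_exp_mul_rpow hpq, expRpowIntegral]
  refine setIntegral_congr_fun measurableSet_Ioi fun x hx => ?_
  simp only [add_zero]
  rw [Real.rpow_add hx, mul_assoc]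

/-- Kummer's transformation for `expRpowIntegral`. -/
lemma gamma_mul_expRpowIntegral {p q L : ℝ} (hp : -1 < p) (hq : q < 0) (hL : 0 < L) :
    Real.Gamma (-q) * expRpowIntegral p q L =
      Real.Gamma (p + 1) * (L ^ (p + q + 1) * expRpowIntegral (-q - 1) (-p - 1) L) := by
  have hs : ∀ x, 0 < x → ∫ s in Set.Ioi (0 : ℝ), s ^ (-q - 1) * Real.exp (-((x + L) * s)) =
      Real.Gamma (-q) * (x + L) ^ q := by
    intro x hx
    rw [Real.integral_rpow_mul_exp_neg_mul_Ioi (by linarith) (by linarith), one_div,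
      Real.inv_rpow (by positivity), Real.rpow_neg (by positivity), inv_inv, mul_comm]
  have hsi : ∀ x, 0 < x → IntegrableOn (fun s => s ^ (-q - 1) * Real.exp (-((x + L) * s)))
      (Set.Ioi 0) := by
    intro x hx
    -- A non-integrable function has integral `0` by convention, whereas the value found above is
    -- positive.
    by_contra h
    have := hs x hx
    rw [integral_undef h] at this
    have h2 := Real.Gamma_pos_of_pos (s := -q) (by linarith)
    have h3 : 0 < (x + L) ^ q := by positivity
    exact (mul_pos h2 h3).ne this
  have hx : ∀ s, 0 < s → ∫ x in Set.Ioi (0 : ℝ), x ^ p * Real.exp (-((1 + s) * x)) =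
      Real.Gamma (p + 1) * (1 + s) ^ (-p - 1) := by
    intro s hs
    have := Real.integral_rpow_mul_exp_neg_mul_Ioi (a := p + 1) (r := 1 + s) (by linarith)
      (by linarith)
    rw [add_sub_cancel_right] at this
    rw [this, one_div, Real.inv_rpow (by positivity), ← Real.rpow_neg (by positivity), mul_comm]
    ring_nf
  -- Fubini for this double integral: integrating in `s` first yields `Γ(-q) (x + L)^q`, integrating
  -- in `x` first yields `Γ(p + 1) (1 + s)^(-p - 1)`. Rescaling `s` by `L` then gives the right-hand
  -- side.
  set f : ℝ → ℝ → ℝ := fun x s =>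
    Real.exp (-x) * x ^ p * (s ^ (-q - 1) * Real.exp (-((x + L) * s))) with hf
  have hfm : Measurable (Function.uncurry f) := by
    simp only [hf, Function.uncurry_def]; fun_prop
  have hfi : Integrable (Function.uncurry f)
      ((volume.restrict (Set.Ioi 0)).prod (volume.restrict (Set.Ioi 0))) := by
    rw [integrable_prod_iff hfm.aestronglyMeasurable]
    constructor
    · filter_upwards [ae_restrict_mem measurableSet_Ioi] with x hx
      exact (hsi x hx).const_mul (Real.exp (-x) * x ^ p)
    · refine ((integrableOn_expRpow (q := q) hp (by linarith) hL).const_mul (Real.Gamma (-q))).congr ?_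
      filter_upwards [ae_restrict_mem measurableSet_Ioi] with x hx
      have hx : 0 < x := hx
      calc _ = Real.exp (-x) * x ^ p * (Real.Gamma (-q) * (x + L) ^ q) := by ring
        _ = _ := by
          rw [← hs x hx, ← integral_const_mul]
          refine setIntegral_congr_fun measurableSet_Ioi fun s hs => ?_
          have hs : 0 < s := hs
          simp only [Function.uncurry, hf]
          rw [Real.norm_of_nonneg (by positivity)]
  have hswap := integral_integral_swap hfi
  have hleft : ∫ x in Set.Ioi (0 : ℝ), ∫ s in Set.Ioi (0 : ℝ), f x s =
      Real.Gamma (-q) * expRpowIntegral p q L := by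
    rw [expRpowIntegral, ← integral_const_mul]
    refine setIntegral_congr_fun measurableSet_Ioi fun x hx => ?_
    simp only [hf]
    rw [integral_const_mul, hs x hx]; ring
  have hright : ∫ s in Set.Ioi (0 : ℝ), ∫ x in Set.Ioi (0 : ℝ), f x s =
      Real.Gamma (p + 1) *
        ∫ s in Set.Ioi (0 : ℝ), Real.exp (-(L * s)) * s ^ (-q - 1) * (1 + s) ^ (-p - 1) := by
    rw [← integral_const_mul]
    refine setIntegral_congr_fun measurableSet_Ioi fun s hs => ?_
    calc _ = ∫ x in Set.Ioi (0 : ℝ), Real.exp (-(L * s)) * s ^ (-q - 1) *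
          (x ^ p * Real.exp (-((1 + s) * x))) := by
          congr 1; ext x
          simp only [hf]
          have e : Real.exp (-((1 + s) * x)) * Real.exp (-(L * s)) =
              Real.exp (-x) * Real.exp (-((x + L) * s)) := by
            rw [← Real.exp_add, ← Real.exp_add]; ring_nf
          linear_combination -(x ^ p * s ^ (-q - 1)) * e
      _ = _ := by rw [integral_const_mul, hx s hs]; ring
  rw [← hleft, hswap, hright]
  congr 1
  have hcv := integral_comp_mul_left_Ioi
    (fun y => Real.exp (-y) * y ^ (-q - 1) * (y + L) ^ (-p - 1)) 0 hL
  rw [mul_zero, smul_eq_mul] at hcv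
  rw [expRpowIntegral]
  have e2 : L ^ (p + q + 1) = L ^ (p + q + 2) * L⁻¹ := by
    rw [← Real.rpow_neg_one, ← Real.rpow_add hL]; ring_nf
  rw [e2, mul_assoc, ← hcv, ← integral_const_mul]
  refine setIntegral_congr_fun measurableSet_Ioi fun s hs => ?_
  have hs : 0 < s := hs
  rw [show L * s + L = L * (1 + s) by ring, Real.mul_rpow hL.le hs.le,
    Real.mul_rpow hL.le (by positivity)]
  have e3 : L ^ (p + q + 2) * L ^ (-q - 1) * L ^ (-p - 1) = 1 := by
    rw [← Real.rpow_add hL, ← Real.rpow_add hL]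
    ring_nf
    simp
  linear_combination -(Real.exp (-(L * s)) * s ^ (-q - 1) * (1 + s) ^ (-p - 1)) * e3

/-- `expRpowIntegral β β` solves Kummer's equation with parameters `-β`, `-2β`. -/
lemma expRpowIntegral_ode {β L : ℝ} (hβ0 : 0 < β) (hβ1 : β < 1) (hL : 0 < L) :
    L * (β * ((β - 1) * expRpowIntegral β (β - 1 - 1) L)) +
      (-(2 * β) - L) * (β * expRpowIntegral β (β - 1) L) - -β * expRpowIntegral β β L = 0 := by
  -- Up to the factor `β`, the equation's left-hand side is the integral of `F'`, and `F' = -dF/dx`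
  -- is exact, with `F` vanishing at `0` and at infinity.
  set F : ℝ → ℝ := fun x => Real.exp (-x) * x ^ (β + 1) * (x + L) ^ (β - 1)
  set F' : ℝ → ℝ := fun x => (L * (β - 1)) * (Real.exp (-x) * x ^ β * (x + L) ^ (β - 1 - 1)) +
      (-(2 * β) - L) * (Real.exp (-x) * x ^ β * (x + L) ^ (β - 1)) +
      Real.exp (-x) * x ^ β * (x + L) ^ β with hF'
  have i1 := integrableOn_expRpow (p := β) (q := β - 1 - 1) (by linarith) (by linarith) hL
  have i2 := integrableOn_expRpow (p := β) (q := β - 1) (by linarith) (by linarith) hL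
  have i3 := integrableOn_expRpow (p := β) (q := β) (by linarith) (by linarith) hL
  have hint : IntegrableOn F' (Set.Ioi 0) :=
    ((i1.const_mul _).add (i2.const_mul _)).add i3
  have hderiv : ∀ x ∈ Set.Ioi (0 : ℝ), HasDerivAt F (-F' x) x := by
    intro x hx
    have hx : 0 < x := hx
    have h1 : HasDerivAt (fun z => Real.exp (-z)) (-Real.exp (-x)) x := by
      simpa using (hasDerivAt_neg x).exp
    have h2 := Real.hasDerivAt_rpow_const (x := x) (p := β + 1) (Or.inl hx.ne')
    have h3 : HasDerivAt (fun y => (y + L) ^ (β - 1)) _ x :=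
      ((hasDerivAt_id x).add_const L).rpow_const (p := β - 1) (Or.inl (by simp; positivity))
    refine ((h1.mul h2).mul h3).congr_deriv ?_
    simp only [Pi.mul_apply, hF', id]
    have e1 : (x + L) ^ (β - 1) = (x + L) ^ (β - 1 - 1) * (x + L) := by
      rw [← Real.rpow_add_one (by positivity)]; ring_nf
    have e2 : (x + L) ^ β = (x + L) ^ (β - 1 - 1) * (x + L) * (x + L) := by
      rw [← e1, ← Real.rpow_add_one (by positivity)]; ring_nf
    have e3 : x ^ (β + 1) = x ^ β * x := Real.rpow_add_one hx.ne' _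
    have e4 : x ^ (β + 1 - 1) = x ^ β := by ring_nf
    rw [e2, e1, e3, e4]
    ring
  have hcont : ContinuousWithinAt F (Set.Ici 0) 0 := by
    refine ContinuousAt.continuousWithinAt ?_
    refine ContinuousAt.mul (ContinuousAt.mul (by fun_prop) ?_) ?_
    · exact Real.continuousAt_rpow_const _ _ (Or.inr (by linarith))
    · exact ContinuousAt.rpow_const (by fun_prop) (Or.inl (by simpa using hL.ne'))
  have hlim : Tendsto F atTop (𝓝 0) := by
    have h1 := Real.tendsto_pow_mul_exp_neg_atTop_nhds_zero 2
    have h2 := h1.const_mul (L ^ (β - 1))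
    rw [mul_zero] at h2
    refine squeeze_zero' ?_ ?_ h2
    · filter_upwards [eventually_gt_atTop 0] with x hx using expRpow_nonneg hL.le hx
    · filter_upwards [eventually_ge_atTop 1] with x hx
      have h3 : x ^ (β + 1) ≤ x ^ 2 := by
        rw [← Real.rpow_natCast]
        exact Real.rpow_le_rpow_of_exponent_le hx (by push_cast; linarith)
      have h4 : (x + L) ^ (β - 1) ≤ L ^ (β - 1) :=
        Real.rpow_le_rpow_of_nonpos hL (by linarith) (by linarith)
      calc F x ≤ Real.exp (-x) * x ^ 2 * L ^ (β - 1) := by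
            simp only [F]; gcongr
        _ = _ := by ring
  have h0 : F 0 = 0 := by simp [F, Real.zero_rpow (by linarith : β + 1 ≠ 0)]
  have := integral_Ioi_of_hasDerivAt_of_tendsto hcont hderiv hint.neg hlim
  rw [h0, sub_zero, integral_neg, neg_eq_zero] at this
  have h2 : ∫ x in Set.Ioi (0 : ℝ), F' x = L * (β - 1) * expRpowIntegral β (β - 1 - 1) L +
      (-(2 * β) - L) * expRpowIntegral β (β - 1) L + expRpowIntegral β β L := by
    have e1 := integral_add ((i1.const_mul (L * (β - 1))).add (i2.const_mul (-(2 * β) - L))) i3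
    have e2 := integral_add (i1.const_mul (L * (β - 1))) (i2.const_mul (-(2 * β) - L))
    rw [integral_const_mul, integral_const_mul] at e2
    simp only [Pi.add_apply] at e1
    rw [hF', e1, e2]
    rfl
  rw [h2] at this
  linear_combination β * this

/-- The integral representation of Tricomi's function on the parameter range of Hadamard
fractional Brownian motion. -/
theorem expRpowIntegral_eq_tricomiPsi {β L : ℝ} (hβ0 : 0 < β) (hβ1 : β < 1 / 2) (hL : 0 ≤ L) :
    expRpowIntegral β β L = Real.Gamma (β + 1) * tricomiPsi (-β) (-(2 * β)) L := by
  have hGβ : Real.Gamma (β + 1) ≠ 0 := (Real.Gamma_pos_of_pos (by linarith)).ne'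
  have hexp : tricomiPsi (-β) (-(2 * β)) L =
      Real.Gamma (2 * β + 1) / Real.Gamma (β + 1) * kummerPhi (-β) (-(2 * β)) L +
        Real.Gamma (-(2 * β) - 1) / Real.Gamma (-β) * L ^ (1 + 2 * β) *
          kummerPhi (1 + β) (2 + 2 * β) L := by
    rw [tricomiPsi]; ring_nf
  rcases hL.eq_or_lt with rfl | hL
  · rw [expRpowIntegral_zero (by linarith), hexp, kummerPhi_zero, Real.zero_rpow (by linarith)]
    field_simp
    ring_nf
  have hb1 : ∀ l : ℕ, -(2 * β) + l ≠ 0 := by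
    intro l
    rcases Nat.eq_zero_or_pos l with rfl | h
    · simp; exact hβ0.ne'
    · have : (1 : ℝ) ≤ l := by exact_mod_cast h
      linarith
  have hb2 : ∀ l : ℕ, 2 + 2 * β + l ≠ 0 := fun l => by positivity
  obtain ⟨φ', φ'', hφ, hφ', hφc, hφode⟩ := exists_kummerPhi_ode (a := -β) hb1
  obtain ⟨ψ', ψ'', hψ, hψ', hψc, hψode⟩ := exists_kummerPhi_ode (a := 1 + β) hb2
  set φ := kummerPhi (-β) (-(2 * β)) with hφdef
  set ψ := kummerPhi (1 + β) (2 + 2 * β) with hψdef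
  set A := Real.Gamma (2 * β + 1) with hA
  have lim_of_cont : ∀ {f : ℝ → ℝ}, (∀ z, ContinuousAt f z) → Tendsto f (𝓝[>] 0) (𝓝 (f 0)) :=
    fun h => (h 0).tendsto.mono_left nhdsWithin_le_nhds
  have lid : Tendsto (fun z : ℝ => z) (𝓝[>] 0) (𝓝 0) := nhdsWithin_le_nhds
  have lφ := lim_of_cont fun z => (hφ z).continuousAt
  have lφ' := lim_of_cont fun z => (hφ' z).continuousAt
  have lφ'' := lim_of_cont fun z => hφc.continuousAt (x := z)
  have lψ := lim_of_cont fun z => (hψ z).continuousAt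
  have lψ' := lim_of_cont fun z => (hψ' z).continuousAt
  have lψ'' := lim_of_cont fun z => hψc.continuousAt (x := z)
  have φ0 : φ 0 = 1 := kummerPhi_zero _ _
  have ψ0 : ψ 0 = 1 := kummerPhi_zero _ _
  rw [φ0] at lφ
  rw [ψ0] at lψ
  -- `A` is the value of the integral at `0`, so subtracting `A φ` leaves a solution vanishing at
  -- `0`; it should be a multiple `k u` of the second solution.
  set w : ℝ → ℝ := fun z => expRpowIntegral β β z - A * φ z with hw
  set w' : ℝ → ℝ := fun z => β * expRpowIntegral β (β - 1) z - A * φ' z with hw'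
  set w'' : ℝ → ℝ := fun z =>
    β * ((β - 1) * expRpowIntegral β (β - 1 - 1) z) - A * φ'' z with hw''
  set u : ℝ → ℝ := fun z => z ^ (1 + 2 * β) * ψ z with hu
  set u' : ℝ → ℝ := fun z => (1 + 2 * β) * z ^ (2 * β) * ψ z + z ^ (1 + 2 * β) * ψ' z with hu'
  set u'' : ℝ → ℝ := fun z => (1 + 2 * β) * (2 * β) * z ^ (2 * β - 1) * ψ z +
    2 * (1 + 2 * β) * z ^ (2 * β) * ψ' z + z ^ (1 + 2 * β) * ψ'' z with hu''
  have dw : ∀ z, 0 < z → HasDerivAt w (w' z) z := fun z hz =>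
    (hasDerivAt_expRpowIntegral (by linarith) (by linarith) hz).sub ((hφ z).const_mul A)
  have dw' : ∀ z, 0 < z → HasDerivAt w' (w'' z) z := fun z hz =>
    ((hasDerivAt_expRpowIntegral (by linarith) (by linarith) hz).const_mul β).sub
      ((hφ' z).const_mul A)
  have dr : ∀ z, 0 < z → HasDerivAt (fun z : ℝ => z ^ (1 + 2 * β)) ((1 + 2 * β) * z ^ (2 * β)) z := by
    intro z hz
    have := Real.hasDerivAt_rpow_const (x := z) (p := 1 + 2 * β) (Or.inl hz.ne')
    rwa [add_sub_cancel_left] at this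
  have dr' : ∀ z, 0 < z → HasDerivAt (fun z : ℝ => z ^ (2 * β)) (2 * β * z ^ (2 * β - 1)) z :=
    fun z hz => Real.hasDerivAt_rpow_const (x := z) (p := 2 * β) (Or.inl hz.ne')
  have du : ∀ z, 0 < z → HasDerivAt u (u' z) z := fun z hz => (dr z hz).mul (hψ z)
  have du' : ∀ z, 0 < z → HasDerivAt u' (u'' z) z := fun z hz => by
    refine ((((dr' z hz).const_mul (1 + 2 * β)).mul (hψ z)).add
      ((dr z hz).mul (hψ' z))).congr_deriv ?_
    simp only [hu'']; ring
  have pw1 : ∀ z : ℝ, 0 < z → z ^ (1 + 2 * β) = z ^ (2 * β - 1) * z * z := fun z hz => by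
    rw [← Real.rpow_add_one hz.ne', ← Real.rpow_add_one hz.ne']; ring_nf
  have pw2 : ∀ z : ℝ, 0 < z → z ^ (2 * β) = z ^ (2 * β - 1) * z := fun z hz => by
    rw [← Real.rpow_add_one hz.ne']; ring_nf
  have pw3 : ∀ z : ℝ, 0 < z → z ^ (-(2 * β)) * (z ^ (2 * β - 1) * z) = 1 := fun z hz => by
    rw [← pw2 z hz, ← Real.rpow_add hz]; simp
  have pw4 : ∀ z : ℝ, 0 < z → z ^ (1 - 2 * β) * z ^ (2 * β - 1) = 1 := fun z hz => by
    rw [← Real.rpow_add hz]; simp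
  have wode : ∀ z, 0 < z → z * w'' z + (-(2 * β) - z) * w' z - -β * w z = 0 := fun z hz => by
    have h1 := expRpowIntegral_ode hβ0 (by linarith) hz
    have h2 := hφode z
    simp only [hw, hw', hw'']
    linear_combination h1 - A * h2
  have uode : ∀ z, 0 < z → z * u'' z + (-(2 * β) - z) * u' z - -β * u z = 0 := fun z hz => by
    have h2 := hψode z
    simp only [hu, hu', hu'']
    rw [pw1 z hz, pw2 z hz]
    linear_combination z ^ (2 * β - 1) * z * z * h2
  have upos : ∀ z, 0 < z → u z ≠ 0 := fun z hz => by
    have := one_le_kummerPhi (a := 1 + β) (b := 2 + 2 * β) (by linarith) (by linarith) hz.le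
    exact (mul_pos (Real.rpow_pos_of_pos hz _) (by linarith)).ne'
  have lJ0 := tendsto_expRpowIntegral (p := β) (q := β) (by linarith) (by linarith) (by linarith)
  have lJ1 := tendsto_expRpowIntegral (p := β) (q := β - 1) (by linarith) (by linarith) (by linarith)
  have lw : Tendsto w (𝓝[>] 0) (𝓝 0) := by
    have := lJ0.sub (lφ.const_mul A)
    rwa [hA, mul_one, show β + β + 1 = 2 * β + 1 by ring, sub_self] at this
  have lzw' : Tendsto (fun z => z * w' z) (𝓝[>] 0) (𝓝 0) := by
    have := lid.mul ((lJ1.const_mul β).sub (lφ'.const_mul A))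
    rwa [zero_mul] at this
  -- The factor `z ^ (-2β)` exactly offsets the leading power of `u'` and leaves one factor `z` with
  -- `u`, so the limit needs only `w → 0` and `z w' → 0`.
  have hwr : Tendsto (fun z => z ^ (-(2 * β)) * (w z * u' z - w' z * u z)) (𝓝[>] 0) (𝓝 0) := by
    have h := (lw.mul ((lψ.const_mul (1 + 2 * β)).add (lid.mul lψ'))).sub (lzw'.mul lψ)
    simp only [zero_mul, sub_zero] at h
    refine h.congr' ?_
    filter_upwards [self_mem_nhdsWithin] with z hz
    have hz : 0 < z := hz
    simp only [hu, hu']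
    rw [pw1 z hz, pw2 z hz]
    linear_combination -(w z * ((1 + 2 * β) * ψ z + z * ψ' z) - z * w' z * ψ z) * pw3 z hz
  obtain ⟨k, hk⟩ := eq_const_mul_of_kummer_ode dw dw' wode du du' uode upos hwr
  have hk' : ∀ z, 0 < z → w' z = k * u' z := fun z hz =>
    (dw z hz).unique (((du z hz).const_mul k).congr_of_eventuallyEq (by
      filter_upwards [Ioi_mem_nhds hz] with y hy using hk y hy))
  have hk'' : ∀ z, 0 < z → w'' z = k * u'' z := fun z hz =>
    (dw' z hz).unique (((du' z hz).const_mul k).congr_of_eventuallyEq (by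
      filter_upwards [Ioi_mem_nhds hz] with y hy using hk' y hy))
  -- The constant `k` is read off from second derivatives, the first order at which `u` is singular:
  -- `u''` grows like `z ^ (2β - 1)` while `φ''` stays bounded and, as `β < 1/2`, drops out.
  have lim1 : Tendsto (fun z => z ^ (1 - 2 * β) * w'' z) (𝓝[>] 0)
      (𝓝 (k * ((1 + 2 * β) * (2 * β)))) := by
    have h := ((lψ.const_mul ((1 + 2 * β) * (2 * β))).add ((lid.mul lψ').const_mul
      (2 * (1 + 2 * β)))).add ((lid.mul lid).mul lψ'')
    have h' := h.const_mul k
    simp only [zero_mul, mul_zero, add_zero, mul_one] at h'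
    refine h'.congr' ?_
    filter_upwards [self_mem_nhdsWithin] with z hz
    have hz : 0 < z := hz
    rw [hk'' z hz]
    simp only [hu'']
    rw [pw1 z hz, pw2 z hz]
    linear_combination -k * ((1 + 2 * β) * (2 * β) * ψ z + 2 * (1 + 2 * β) * z * ψ' z +
      z * z * ψ'' z) * pw4 z hz
  have hG2 : Real.Gamma (2 - β) ≠ 0 := (Real.Gamma_pos_of_pos (by linarith)).ne'
  have lim2 : Tendsto (fun z => z ^ (1 - 2 * β) * w'' z) (𝓝[>] 0)
      (𝓝 (β * (β - 1) * (Real.Gamma (β + 1) / Real.Gamma (2 - β) * Real.Gamma (1 - 2 * β)))) := by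
    have h1 := tendsto_expRpowIntegral (p := 1 - β) (q := -β - 1) (by linarith) (by linarith)
      (by linarith)
    rw [show 1 - β + (-β - 1) + 1 = 1 - 2 * β by ring] at h1
    have h2 : Tendsto (fun z : ℝ => z ^ (1 - 2 * β)) (𝓝[>] 0) (𝓝 0) := by
      have := lim_of_cont (f := fun z : ℝ => z ^ (1 - 2 * β)) fun z =>
        Real.continuousAt_rpow_const _ _ (Or.inr (by linarith))
      rwa [Real.zero_rpow (by linarith)] at this
    have h := ((h1.const_mul (Real.Gamma (β + 1) / Real.Gamma (2 - β))).const_mul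
      (β * (β - 1))).sub ((h2.mul lφ'').const_mul A)
    simp only [zero_mul, mul_zero, sub_zero] at h
    refine h.congr' ?_
    filter_upwards [self_mem_nhdsWithin] with z hz
    have hz : 0 < z := hz
    -- The integral in `w''` diverges at `0`; Kummer's transformation extracts the power `z ^ (2β -
    -- 1)` and leaves an integral with a finite limit.
    have h3 := gamma_mul_expRpowIntegral (p := β) (q := β - 1 - 1) (L := z) (by linarith)
      (by linarith) hz
    rw [show -(β - 1 - 1) = 2 - β by ring, show β + (β - 1 - 1) + 1 = 2 * β - 1 by ring,
      show 2 - β - 1 = 1 - β by ring] at h3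
    have h4 : expRpowIntegral β (β - 1 - 1) z = Real.Gamma (β + 1) / Real.Gamma (2 - β) *
        (z ^ (2 * β - 1) * expRpowIntegral (1 - β) (-β - 1) z) := by
      rw [div_mul_eq_mul_div, eq_div_iff hG2]; linear_combination h3
    simp only [hw'']
    rw [h4]
    linear_combination -(β * (β - 1) * (Real.Gamma (β + 1) / Real.Gamma (2 - β)) *
      expRpowIntegral (1 - β) (-β - 1) z) * pw4 z hz
  have hkk := tendsto_nhds_unique lim1 lim2
  have g1 : Real.Gamma (1 - 2 * β) = (-(2 * β)) * ((-(2 * β) - 1) * Real.Gamma (-(2 * β) - 1)) := by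
    have e1 := Real.Gamma_add_one (s := -(2 * β)) (by linarith)
    have e2 := Real.Gamma_add_one (s := -(2 * β) - 1) (by linarith)
    rw [sub_add_cancel] at e2
    rw [← e2, ← e1]; ring_nf
  have g2 : Real.Gamma (2 - β) = (1 - β) * (-β * Real.Gamma (-β)) := by
    have e1 := Real.Gamma_add_one (s := -β) (by linarith)
    have e2 := Real.Gamma_add_one (s := 1 - β) (by linarith)
    rw [← e1, show -β + 1 = 1 - β by ring, ← e2]; ring_nf
  have hG3 : Real.Gamma (-β) ≠ 0 := by
    intro h; rw [g2, h] at hG2; simp at hG2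
  have hk3 : k = Real.Gamma (β + 1) * (Real.Gamma (-(2 * β) - 1) / Real.Gamma (-β)) := by
    have n1 : 1 + 2 * β ≠ 0 := by linarith
    have n2 : 1 - β ≠ 0 := by linarith
    rw [g1, g2] at hkk
    have : k * ((1 + 2 * β) * (2 * β)) = (Real.Gamma (β + 1) * (Real.Gamma (-(2 * β) - 1) /
        Real.Gamma (-β))) * ((1 + 2 * β) * (2 * β)) := by
      rw [hkk]; field_simp; ring
    exact mul_right_cancel₀ (by positivity) this
  have hfin := hk L hL
  simp only [hw, hu] at hfin
  have h5 : Real.Gamma (β + 1) * (A / Real.Gamma (β + 1) * φ L) = A * φ L := by field_simp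
  rw [hk3] at hfin
  rw [hexp]
  linear_combination hfin - h5

/-! ### The response function and the covariance as an inner product -/

lemma measurable_response (β : ℝ) : Measurable (response β) := by
  unfold response
  exact (Real.measurable_log.pow_const β).indicator measurableSet_Ici

lemma response_of_lt {β x : ℝ} (hx : x < 1) : response β x = 0 := by
  simp [response, hx]

/-- The condition `β ≠ 0` matters only at `x = 1`, where `0 ^ 0` would be `1`. -/
lemma response_of_le {β x : ℝ} (hβ : β ≠ 0) (hx : x ≤ 1) : response β x = 0 := by
  rcases hx.eq_or_lt with rfl | hx
  · simp [response, Real.zero_rpow hβ]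
  · exact response_of_lt hx

lemma response_of_ge {β x : ℝ} (hx : 1 ≤ x) : response β x = Real.log x ^ β := by
  simp [response, hx]

lemma response_div_eq_zero {β s v : ℝ} (hβ : β ≠ 0) (hv : 0 < v) (hsv : s ≤ v) :
    response β (s / v) = 0 :=
  response_of_le hβ ((div_le_one hv).2 hsv)

section Substitution

variable {s : ℝ} {g : ℝ → ℝ}

lemma image_mul_exp_neg (hs : 0 < s) :
    (fun x => s * Real.exp (-x)) '' Set.Ioi 0 = Set.Ioo 0 s := by
  ext v
  constructor
  · rintro ⟨x, hx, rfl⟩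
    have hx : 0 < x := hx
    refine ⟨by positivity, ?_⟩
    have : Real.exp (-x) < 1 := Real.exp_lt_one_iff.2 (by linarith)
    nlinarith
  · rintro ⟨h0, h1⟩
    refine ⟨Real.log (s / v), Real.log_pos ((one_lt_div h0).2 h1), ?_⟩
    simp only
    rw [Real.exp_neg, Real.exp_log (by positivity)]
    field_simp

lemma hasDerivWithinAt_mul_exp_neg (x : ℝ) :
    HasDerivWithinAt (fun x => s * Real.exp (-x)) (-(s * Real.exp (-x))) (Set.Ioi 0) x := by
  have : HasDerivAt (fun x => Real.exp (-x)) (-Real.exp (-x)) x := by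
    simpa using (hasDerivAt_neg x).exp
  simpa using (this.const_mul s).hasDerivWithinAt

lemma injOn_mul_exp_neg (hs : 0 < s) : Set.InjOn (fun x => s * Real.exp (-x)) (Set.Ioi 0) := by
  intro x _ y _ h
  simpa [hs.ne'] using h

/-- The substitution `v = s e⁻ˣ` maps `(0, ∞)` onto `(0, s)` and turns `log (s / v)` into `x`. -/
lemma setIntegral_Ioi_eq_exp_subst (hs : 0 < s) (hg : ∀ v, s ≤ v → g v = 0) :
    ∫ v in Set.Ioi 0, g v = ∫ x in Set.Ioi 0, s * Real.exp (-x) * g (s * Real.exp (-x)) := by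
  rw [setIntegral_eq_of_subset_of_forall_sdiff_eq_zero (s := Set.Ioo 0 s) measurableSet_Ioi
    Set.Ioo_subset_Ioi_self, ← image_mul_exp_neg hs,
    integral_image_eq_integral_abs_deriv_smul measurableSet_Ioi
      (fun x _ => hasDerivWithinAt_mul_exp_neg x) (injOn_mul_exp_neg hs)]
  · congr 1; ext x
    rw [abs_neg, abs_of_pos (by positivity), smul_eq_mul]
  · rintro v ⟨h0, h1⟩
    refine hg v ?_
    by_contra h
    exact h1 ⟨h0, not_le.1 h⟩

lemma integrableOn_Ioi_of_exp_subst (hs : 0 < s) (hg : ∀ v, s ≤ v → g v = 0)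
    (h : IntegrableOn (fun x => s * Real.exp (-x) * g (s * Real.exp (-x))) (Set.Ioi 0)) :
    IntegrableOn g (Set.Ioi 0) := by
  have h1 : IntegrableOn g (Set.Ioo 0 s) := by
    rw [← image_mul_exp_neg hs, integrableOn_image_iff_integrableOn_abs_deriv_smul measurableSet_Ioi
      (fun x _ => hasDerivWithinAt_mul_exp_neg x) (injOn_mul_exp_neg hs)]
    refine h.congr_fun (fun x _ => ?_) measurableSet_Ioi
    simp only [abs_neg, smul_eq_mul]
    rw [abs_of_pos (by positivity)]
  refine h1.of_forall_sdiff_eq_zero measurableSet_Ioi ?_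
  rintro v ⟨h0, h1⟩
  refine hg v ?_
  by_contra h
  exact h1 ⟨h0, not_le.1 h⟩

end Substitution

lemma response_div_mul_exp_neg {β s t x : ℝ} (hs : 0 < s) (hst : s ≤ t) (hx : 0 < x) :
    response β (t / (s * Real.exp (-x))) = (x + Real.log (t / s)) ^ β := by
  have ht : 0 < t := hs.trans_le hst
  have h1 : t / (s * Real.exp (-x)) = Real.exp x * (t / s) := by
    rw [Real.exp_neg]; field_simp
  have h2 : 1 ≤ t / s := (one_le_div hs).2 hst
  have h3 : 1 ≤ Real.exp x := Real.one_le_exp hx.le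
  rw [h1, response_of_ge (one_le_mul_of_one_le_of_one_le h3 h2),
    Real.log_mul (Real.exp_pos x).ne' (by positivity), Real.log_exp]

lemma memLp_response_div {β : ℝ} (hβ : 0 < β) (t : ℝ≥0) :
    MemLp (fun v => response β (t / v)) 2 (volume.restrict (Set.Ioi 0)) := by
  have hm : Measurable fun v : ℝ => response β (t / v) :=
    (measurable_response β).comp (measurable_const.div measurable_id)
  rw [memLp_two_iff_integrable_sq hm.aestronglyMeasurable]
  rcases eq_or_ne t 0 with rfl | ht
  · simp [response_of_lt]
  have ht' : (0 : ℝ) < t := by positivity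
  refine integrableOn_Ioi_of_exp_subst ht' (fun v hv => ?_) ?_
  · rw [response_div_eq_zero hβ.ne' (ht'.trans_le hv) hv]; simp
  · refine IntegrableOn.congr_fun
      ((integrableOn_exp_mul_rpow (p := β + β) (by linarith)).const_mul (t : ℝ))
      (fun x hx => ?_) measurableSet_Ioi
    have hx : 0 < x := hx
    rw [response_div_mul_exp_neg ht' le_rfl hx, div_self ht'.ne', Real.log_one, add_zero,
      Real.rpow_add hx]
    ring

/-- The covariance of Hadamard fractional Brownian motion as an `L²` inner product. -/
theorem integral_response_mul_response {α : ℝ} (hα : 1 < α ∧ α < 2) (s t : ℝ≥0) :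
    ∫ v in Set.Ioi (0 : ℝ), response ((α - 1) / 2) (s / v) * response ((α - 1) / 2) (t / v) =
      Real.Gamma α * hadamardCov α s t := by
  wlog hst : s ≤ t generalizing s t
  · have h := this t s (not_le.1 hst).le
    have hc : hadamardCov α s t = hadamardCov α t s := by
      rw [hadamardCov, hadamardCov, min_comm, max_comm]
    rw [hc, ← h]
    congr 1; ext v; ring
  set β := (α - 1) / 2 with hβ
  have hβ0 : 0 < β := by rw [hβ]; linarith [hα.1]
  have hst' : (s : ℝ) ≤ t := by exact_mod_cast hst
  rcases eq_or_ne s 0 with rfl | hs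
  · simp [response_of_lt, hadamardCov]
  have hs' : (0 : ℝ) < s := by positivity
  have hL : 0 ≤ Real.log (t / s) := Real.log_nonneg ((one_le_div hs').2 hst')
  have h1 : ∫ v in Set.Ioi (0 : ℝ), response β (s / v) * response β (t / v) =
      s * expRpowIntegral β β (Real.log (t / s)) := by
    rw [setIntegral_Ioi_eq_exp_subst hs', expRpowIntegral, ← integral_const_mul]
    · refine setIntegral_congr_fun measurableSet_Ioi fun x hx => ?_
      rw [response_div_mul_exp_neg hs' le_rfl hx, response_div_mul_exp_neg hs' hst' hx,
        div_self hs'.ne', Real.log_one, add_zero]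
      ring
    · intro v hv
      rw [response_div_eq_zero hβ0.ne' (hs'.trans_le hv) hv, zero_mul]
  rw [h1, expRpowIntegral_eq_tricomiPsi hβ0 (by rw [hβ]; linarith [hα.2]) hL, hadamardCov,
    min_eq_left hst', max_eq_right hst', constC]
  rw [show -β = (1 - α) / 2 by rw [hβ]; ring, show -(2 * β) = 1 - α by rw [hβ]; ring]
  -- Legendre's duplication formula at `α / 2`, as `β + 1 = α / 2 + 1 / 2`; this is the origin of
  -- `C_α`.
  have hleg := Real.Gamma_mul_Gamma_add_half (α / 2)
  rw [show α / 2 + 1 / 2 = β + 1 by rw [hβ]; ring, show 2 * (α / 2) = α by ring] at hleg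
  have hG : Real.Gamma (α / 2) ≠ 0 := (Real.Gamma_pos_of_pos (by linarith [hα.1])).ne'
  have h2 : Real.Gamma (β + 1) = Real.Gamma α * (2 ^ (1 - α) * √Real.pi / Real.Gamma (α / 2)) := by
    rw [mul_div_assoc', eq_div_iff hG]; linear_combination hleg
  rw [h2]; ring

lemma integrable_response_mul_response {β : ℝ} (hβ : 0 < β) (s t : ℝ≥0) :
    IntegrableOn (fun v => response β (s / v) * response β (t / v)) (Set.Ioi 0) :=
  (memLp_response_div hβ s).integrable_mul (memLp_response_div hβ t)

/-! ### Gaussian Hilbert spaces and existence of the limit process -/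

lemma norm_cexp_sub_cexp_le (x y : ℝ) :
    ‖Complex.exp (x * Complex.I) - Complex.exp (y * Complex.I)‖ ≤ |x - y| := by
  have h : Complex.exp (x * Complex.I) - Complex.exp (y * Complex.I) =
      Complex.exp (y * Complex.I) * (Complex.exp (Complex.I * ((x - y : ℝ) : ℂ)) - 1) := by
    rw [mul_sub, ← Complex.exp_add, mul_one]
    congr 2
    push_cast; ring
  rw [h, norm_mul, Complex.norm_exp_ofReal_mul_I, one_mul]
  exact Real.norm_exp_I_mul_ofReal_sub_one_le

section Isonormal

variable {Ω : Type*} [MeasurableSpace Ω] {P : Measure Ω} [IsProbabilityMeasure P]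

lemma integrable_cexp_mul_I {X : Ω → ℝ} (hX : AEStronglyMeasurable X P) :
    Integrable (fun ω => Complex.exp (X ω * Complex.I)) P := by
  refine Integrable.mono' (integrable_const (1 : ℝ)) ?_ (ae_of_all _ fun ω => ?_)
  · exact Complex.continuous_exp.comp_aestronglyMeasurable
      ((Complex.continuous_ofReal.comp_aestronglyMeasurable hX).mul_const _)
  · rw [Complex.norm_exp_ofReal_mul_I]

lemma integral_abs_le_norm_Lp_two (f : Lp ℝ 2 P) : ∫ ω, |f ω| ∂P ≤ ‖f‖ := by
  rw [Lp.norm_def]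
  have h : ∫ ω, |f ω| ∂P = (eLpNorm f 1 P).toReal := by
    rw [eLpNorm_one_eq_lintegral_enorm, ← integral_norm_eq_lintegral_enorm (Lp.aestronglyMeasurable f)]
    rfl
  rw [h]
  exact ENNReal.toReal_mono (Lp.eLpNorm_ne_top f)
    (eLpNorm_le_eLpNorm_of_exponent_le (by norm_num) (Lp.aestronglyMeasurable f))

/-- The map is Lipschitz with constant `|θ|`, since `x ↦ exp (i θ x)` is and the `L¹` norm is at
most the `L²` norm. It carries Gaussianity from finite sums to `L²` limits. -/
lemma continuous_charFun_map_Lp (θ : ℝ) :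
    Continuous fun f : Lp ℝ 2 P => charFun (P.map f) θ := by
  have hint : ∀ f : Lp ℝ 2 P,
      charFun (P.map f) θ = ∫ ω, Complex.exp ((θ * f ω : ℝ) * Complex.I) ∂P := fun f => by
    rw [charFun_apply_real, integral_map (Lp.aestronglyMeasurable f).aemeasurable
      (by fun_prop)]
    simp
  have hi : ∀ f : Lp ℝ 2 P, Integrable (fun ω => Complex.exp ((θ * f ω : ℝ) * Complex.I)) P :=
    fun f => integrable_cexp_mul_I ((Lp.aestronglyMeasurable f).const_mul θ)
  refine (LipschitzWith.of_dist_le_mul (K := ‖θ‖₊) fun f g => ?_).continuous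
  rw [dist_eq_norm, hint, hint, ← integral_sub (hi f) (hi g), dist_eq_norm]
  have hfg : Integrable (fun ω => |(f - g) ω|) P :=
    ((Lp.memLp (f - g)).integrable (by norm_num)).abs
  calc _ ≤ ∫ ω, |θ| * |(f - g) ω| ∂P := by
        refine norm_integral_le_of_norm_le (hfg.const_mul _) ?_
        filter_upwards [Lp.coeFn_sub f g] with ω hω
        rw [hω, Pi.sub_apply, ← abs_mul, mul_sub]
        exact norm_cexp_sub_cexp_le _ _
    _ ≤ _ := by
        rw [integral_const_mul, coe_nnnorm, Real.norm_eq_abs]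
        gcongr
        exact integral_abs_le_norm_Lp_two _

end Isonormal

/-- Every real Hilbert space embeds isometrically into an `L²` space of centred Gaussian random
variables. -/
theorem exists_isonormal (H : Type) [NormedAddCommGroup H] [InnerProductSpace ℝ H]
    [CompleteSpace H] :
    ∃ (Ω₀ : Type) (_ : MeasurableSpace Ω₀) (P₀ : Measure Ω₀) (_ : IsProbabilityMeasure P₀)
      (V : H →ₗᵢ[ℝ] Lp ℝ 2 P₀), ∀ x, P₀.map (V x) = gaussianReal 0 (‖x‖₊ ^ 2) := by
  classical
  obtain ⟨w, b, -⟩ := exists_hilbertBasis ℝ H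
  -- Independent standard Gaussians indexed by a Hilbert basis; the isometry sends basis vectors to
  -- coordinates. Finite combinations are Gaussian by independence, the rest follows by `L²` limits.
  set P₀ : Measure (w → ℝ) := Measure.infinitePi fun _ : w => gaussianReal 0 1 with hP₀
  have hmp : ∀ i : w, MeasurePreserving (fun ω : w → ℝ => ω i) P₀ (gaussianReal 0 1) := fun i =>
    measurePreserving_eval_infinitePi _ i
  have hmem : ∀ i : w, MemLp (fun ω : w → ℝ => ω i) 2 P₀ := fun i =>
    (memLp_id_gaussianReal' 2 (by norm_num)).comp_measurePreserving (hmp i)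
  set ξ : w → Lp ℝ 2 P₀ := fun i => (hmem i).toLp with hξ
  have hξc : ∀ i, ξ i =ᵐ[P₀] fun ω => ω i := fun i => (hmem i).coeFn_toLp
  have hindep : iIndepFun (fun (i : w) (ω : w → ℝ) => ω i) P₀ :=
    iIndepFun_infinitePi (X := fun _ x => x) (fun _ => measurable_id)
  have hmean : ∀ i : w, ∫ ω, ω i ∂P₀ = 0 := fun i => by
    rw [← integral_id_gaussianReal (μ := 0) (v := 1), ← (hmp i).map_eq,
      integral_map (hmp i).aemeasurable (by fun_prop)]
  have hsq : ∀ i : w, ∫ ω, ω i * ω i ∂P₀ = 1 := fun i => by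
    have h1 := variance_id_gaussianReal (μ := 0) (v := 1)
    rw [variance_of_integral_eq_zero aemeasurable_id integral_id_gaussianReal, ← (hmp i).map_eq,
      integral_map (hmp i).aemeasurable (by fun_prop)] at h1
    simpa [sq] using h1
  have hinner : ∀ i j, inner ℝ (ξ i) (ξ j) = ∫ ω, ω i * ω j ∂P₀ := fun i j => by
    rw [L2.inner_def]
    refine integral_congr_ae ?_
    filter_upwards [hξc i, hξc j] with ω h1 h2
    rw [h1, h2]; simp [mul_comm]
  have horth : Orthonormal ℝ ξ := by
    rw [orthonormal_iff_ite]
    intro i j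
    rw [hinner]
    split_ifs with h
    · rw [← h, hsq]
    · rw [(hindep.indepFun h).integral_fun_mul_eq_mul_integral
        (hmem i).aestronglyMeasurable (hmem j).aestronglyMeasurable, hmean,
        zero_mul]
  set V := horth.orthogonalFamily.linearIsometry with hV
  refine ⟨w → ℝ, inferInstance, P₀, inferInstance, V.comp b.repr.toLinearIsometry, fun x => ?_⟩
  have hfin : ∀ (c : w → ℝ) (s : Finset w) (θ : ℝ), charFun (P₀.map (∑ i ∈ s, c i • ξ i : Lp ℝ 2 P₀)) θ =
      Complex.exp (-(‖∑ i ∈ s, c i • ξ i‖ ^ 2 * θ ^ 2 / 2 : ℝ)) := by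
    intro c s θ
    have hae : (∑ i ∈ s, c i • ξ i : Lp ℝ 2 P₀) =ᵐ[P₀] fun ω => ∑ i ∈ s, c i * ω i := by
      have h1 := Lp.coeFn_finsetSum (p := 2) (μ := P₀) s (fun i => c i • ξ i)
      have h2 : ∀ᵐ ω ∂P₀, ∀ i ∈ s, (c i • ξ i : Lp ℝ 2 P₀) ω = c i * ω i := by
        rw [Finset.eventually_all]
        intro i _
        filter_upwards [Lp.coeFn_smul (c i) (ξ i), hξc i] with ω h3 h4
        rw [h3, Pi.smul_apply, h4, smul_eq_mul]
      filter_upwards [h1, h2] with ω h3 h4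
      rw [h3, Finset.sum_apply]
      exact Finset.sum_congr rfl h4
    have hnorm : ‖∑ i ∈ s, c i • ξ i‖ ^ 2 = ∑ i ∈ s, c i ^ 2 := by
      rw [← real_inner_self_eq_norm_sq, horth.inner_sum]
      simp [sq]
    have hind : iIndepFun (fun (i : w) (ω : w → ℝ) => c i * ω i) P₀ :=
      iIndepFun_infinitePi (X := fun i x => c i * x) (fun i => by fun_prop)
    rw [Measure.map_congr hae, (hind.restrict s).charFun_map_fun_finsetSum_eq_prod
      (fun i _ => (hmp i).aemeasurable.const_mul (c i)), Finset.prod_apply, hnorm]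
    have hone : ∀ i, charFun (P₀.map fun ω => c i * ω i) θ =
        Complex.exp (-(c i ^ 2 * θ ^ 2 / 2 : ℝ)) := fun i => by
      have : (P₀.map fun ω => c i * ω i) = (gaussianReal 0 1).map (c i * ·) := by
        rw [← (hmp i).map_eq, Measure.map_map (by fun_prop) (by fun_prop)]; rfl
      rw [this, gaussianReal_map_const_mul, charFun_gaussianReal]
      congr 1
      simp
    simp_rw [hone]
    rw [← Complex.exp_sum]
    congr 1
    push_cast
    rw [Finset.sum_neg_distrib, Finset.sum_mul, Finset.sum_div]
  have hsum : HasSum (fun i => b.repr x i • ξ i) (V (b.repr x)) :=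
    horth.orthogonalFamily.hasSum_linearIsometry (b.repr x)
  have : IsProbabilityMeasure (P₀.map (V (b.repr x))) :=
    Measure.isProbabilityMeasure_map (Lp.aestronglyMeasurable _).aemeasurable
  refine Measure.ext_of_charFun (funext fun θ => ?_)
  have l1 := ((continuous_charFun_map_Lp (P := P₀) θ).tendsto _).comp hsum
  have l2 : Tendsto (fun s : Finset w => Complex.exp (-(‖∑ i ∈ s, b.repr x i • ξ i‖ ^ 2 * θ ^ 2 / 2 : ℝ)))
      atTop (𝓝 (Complex.exp (-(‖V (b.repr x)‖ ^ 2 * θ ^ 2 / 2 : ℝ)))) := by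
    have hc : Continuous fun f : Lp ℝ 2 P₀ => Complex.exp (-(‖f‖ ^ 2 * θ ^ 2 / 2 : ℝ)) := by
      fun_prop
    exact (hc.tendsto _).comp hsum
  have := tendsto_nhds_unique (l1.congr fun s => hfin _ s θ) l2
  change charFun (P₀.map (V (b.repr x))) θ = _
  rw [this, charFun_gaussianReal, V.norm_map, LinearIsometryEquiv.norm_map]
  congr 1
  push_cast
  simp

/-- Hadamard fractional Brownian motion exists. -/
theorem exists_isHadamardFBM {α : ℝ} (hα : 1 < α ∧ α < 2) :
    ∃ (Ω₀ : Type) (_ : MeasurableSpace Ω₀) (P₀ : Measure Ω₀) (B₀ : ℝ≥0 → Ω₀ → ℝ),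
      IsHadamardFBM α P₀ B₀ := by
  have hβ : 0 < (α - 1) / 2 := by linarith [hα.1]
  obtain ⟨Ω₀, m₀, P₀, hP₀, V, hV⟩ := exists_isonormal (Lp ℝ 2 (volume.restrict (Set.Ioi (0 : ℝ))))
  have hG : 0 < Real.Gamma α := Real.Gamma_pos_of_pos (by linarith [hα.1])
  set f : ℝ≥0 → Lp ℝ 2 (volume.restrict (Set.Ioi (0 : ℝ))) := fun t =>
    (√(Real.Gamma α))⁻¹ • (memLp_response_div hβ t).toLp with hf
  have hfinner : ∀ s t, inner ℝ (f s) (f t) = hadamardCov α s t := by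
    intro s t
    simp only [hf]
    rw [real_inner_smul_left, real_inner_smul_right, L2.inner_def]
    have : ∫ v in Set.Ioi (0 : ℝ), inner ℝ ((memLp_response_div hβ s).toLp _ v)
        ((memLp_response_div hβ t).toLp _ v) = Real.Gamma α * hadamardCov α s t := by
      rw [← integral_response_mul_response hα]
      refine integral_congr_ae ?_
      filter_upwards [(memLp_response_div hβ s).coeFn_toLp, (memLp_response_div hβ t).coeFn_toLp]
        with v h1 h2
      rw [h1, h2]; simp [mul_comm]
    rw [this, ← mul_assoc, ← mul_assoc, ← mul_inv, Real.mul_self_sqrt hG.le, inv_mul_cancel₀ hG.ne',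
      one_mul]
  have hmean : ∀ x, ∫ ω, V x ω ∂P₀ = 0 := fun x => by
    have h := integral_id_gaussianReal (μ := 0) (v := ‖x‖₊ ^ 2)
    rwa [← hV x, integral_map (Lp.aestronglyMeasurable _).aemeasurable (by fun_prop)] at h
  refine ⟨Ω₀, m₀, P₀, fun t => V (f t), ⟨⟨fun I => ⟨?_⟩⟩, fun t => hmean _, fun s t => ?_⟩⟩
  · refine isGaussian_of_map_eq_gaussianReal fun L => ⟨0, ‖∑ t : I, L (Pi.single t 1) • f t‖₊ ^ 2, ?_⟩
    have hm : AEMeasurable (fun ω => I.restrict fun t => V (f t) ω) P₀ :=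
      aemeasurable_pi_lambda _ fun t => (Lp.aestronglyMeasurable _).aemeasurable
    rw [AEMeasurable.map_map_of_aemeasurable (by fun_prop) hm, ← hV]
    refine Measure.map_congr ?_
    rw [map_sum]
    have h2 : ∀ᵐ ω ∂P₀, ∀ t : I, V (L (Pi.single t 1) • f t) ω = L (Pi.single t 1) * V (f t) ω := by
      rw [ae_all_iff]
      intro t
      rw [map_smul]
      filter_upwards [Lp.coeFn_smul (L (Pi.single t 1)) (V (f t))] with ω h
      rw [h, Pi.smul_apply, smul_eq_mul]
    filter_upwards [Lp.coeFn_finsetSum (p := 2) (μ := P₀) Finset.univ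
      (fun t : I => V (L (Pi.single t 1) • f t)), h2] with ω h3 h4
    rw [h3, Finset.sum_apply, Finset.sum_congr rfl fun t _ => h4 t]
    simp only [Function.comp]
    rw [← ContinuousLinearMap.coe_coe, LinearMap.pi_apply_eq_sum_univ]
    refine Finset.sum_congr rfl fun t _ => ?_
    rw [smul_eq_mul, mul_comm]
    congr 2
    ext i
    simp [Pi.single_apply, eq_comm]
  · have hs := Lp.memLp (V (f s))
    have ht := Lp.memLp (V (f t))
    rw [covariance_eq_sub hs ht, hmean, hmean, zero_mul, sub_zero, ← hfinner, ← V.inner_map_map,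
      L2.inner_def]
    refine integral_congr_ae (ae_of_all _ fun ω => ?_)
    simp [mul_comm]

/-! ### Exponential waiting times and Poisson epochs -/

section Exponential

lemma integral_expMeasure {E : Type*} [NormedAddCommGroup E] [NormedSpace ℝ E] {r : ℝ} (hr : 0 < r)
    (k : ℝ → E) :
    ∫ x, k x ∂(expMeasure r) = ∫ x in Set.Ioi (0 : ℝ), (r * Real.exp (-(r * x))) • k x := by
  have h1 : ∫ x, k x ∂(expMeasure r) = ∫ x, (exponentialPDF r x).toReal • k x := by
    rw [expMeasure, gammaMeasure]
    refine integral_withDensity_eq_integral_toReal_smul ?_ ?_ k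
    · exact (measurable_gammaPDFReal 1 r).ennreal_ofReal
    · exact ae_of_all _ fun x => ENNReal.ofReal_lt_top
  rw [h1, ← integral_Ici_eq_integral_Ioi, ← integral_indicator measurableSet_Ici]
  congr 1; ext x
  by_cases hx : 0 ≤ x
  · rw [Set.indicator_of_mem (Set.mem_Ici.2 hx), exponentialPDF_of_nonneg hx,
      ENNReal.toReal_ofReal (by positivity)]
  · rw [Set.indicator_of_notMem (by simpa using hx), exponentialPDF_of_neg (not_le.1 hx)]
    simp

lemma expMeasure_Iic {r : ℝ} (hr : 0 < r) {x : ℝ} (hx : 0 ≤ x) :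
    expMeasure r (Set.Iic x) = ENNReal.ofReal (1 - Real.exp (-(r * x))) := by
  have := isProbabilityMeasure_expMeasure hr
  rw [← ofReal_cdf, cdf_expMeasure_eq hr, if_pos hx]

end Exponential

section Epochs

variable {Ω : Type*} {r : ℝ} {T : ℕ → Ω → ℝ}

lemma sum_waitingTime (j : ℕ) (ω : Ω) :
    ∑ i ∈ Finset.range (j + 1), waitingTime T i ω = T j ω := by
  induction j with
  | zero => simp [waitingTime]
  | succ j ih => rw [Finset.sum_range_succ, ih]; simp [waitingTime]

lemma strictMono_of_waitingTime_pos {ω : Ω} (h : ∀ j, 0 < waitingTime T j ω) :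
    StrictMono fun j => T j ω :=
  strictMono_nat_of_lt_succ fun j => by simpa [waitingTime] using h (j + 1)

variable [MeasurableSpace Ω] {P : Measure Ω}

lemma IsPoissonEpochs.measurable_waitingTime (hT : IsPoissonEpochs r T P) (j : ℕ) :
    Measurable (waitingTime T j) := by
  cases j with
  | zero => exact hT.measurable 0
  | succ j => exact (hT.measurable (j + 1)).sub (hT.measurable j)

lemma IsPoissonEpochs.measure_waitingTime_le (hT : IsPoissonEpochs r T P) (hr : 0 < r) (j : ℕ)
    {x : ℝ} (hx : 0 ≤ x) :
    P {ω | waitingTime T j ω ≤ x} = ENNReal.ofReal (1 - Real.exp (-(r * x))) := by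
  rw [← expMeasure_Iic hr hx, ← (hT.hasLaw j).map_eq,
    Measure.map_apply (hT.measurable_waitingTime j) measurableSet_Iic]
  rfl

lemma IsPoissonEpochs.ae_waitingTime_pos (hT : IsPoissonEpochs r T P) (hr : 0 < r) :
    ∀ᵐ ω ∂P, ∀ j, 0 < waitingTime T j ω := by
  rw [ae_all_iff]
  intro j
  rw [ae_iff]
  simpa using hT.measure_waitingTime_le hr j le_rfl

/-- By the second Borel–Cantelli lemma infinitely many waiting times exceed `1`, whereas a bounded
increasing sequence has increments tending to `0`. -/
lemma IsPoissonEpochs.ae_tendsto_atTop [IsProbabilityMeasure P] (hT : IsPoissonEpochs r T P) (hr : 0 < r) :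
    ∀ᵐ ω ∂P, Tendsto (fun j => T j ω) atTop atTop := by
  set s : ℕ → Set Ω := fun j => waitingTime T j ⁻¹' Set.Ioi 1 with hs
  have hsm : ∀ j, MeasurableSet (s j) := fun j => hT.measurable_waitingTime j measurableSet_Ioi
  have hind : iIndepSet s P := by
    rw [iIndepSet_iff_meas_biInter hsm]
    exact fun S => hT.iIndepFun.measure_inter_preimage_eq_mul S (fun _ _ => measurableSet_Ioi)
  have hps : ∀ j, P (s j) = ENNReal.ofReal (Real.exp (-(r * 1))) := fun j => by
    have h1 : s j = {ω | waitingTime T j ω ≤ 1}ᶜ := by ext ω; simp [hs]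
    rw [h1, prob_compl_eq_one_sub (measurableSet_le (hT.measurable_waitingTime j) measurable_const),
      hT.measure_waitingTime_le hr j zero_le_one, ← ENNReal.ofReal_one,
      ← ENNReal.ofReal_sub _ (by simp; positivity), sub_sub_cancel]
  have htop : ∑' j, P (s j) = ∞ := by
    simp_rw [hps]
    exact ENNReal.tsum_const_eq_top_of_ne_zero (by simpa using Real.exp_pos _)
  have hlim : ∀ᵐ ω ∂P, ω ∈ limsup s atTop := by
    have := measure_limsup_eq_one hsm hind htop
    rwa [← prob_compl_eq_zero_iff (MeasurableSet.measurableSet_limsup hsm)] at this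
  filter_upwards [hlim, hT.ae_waitingTime_pos hr] with ω h1 h2
  rcases tendsto_atTop_of_monotone (strictMono_of_waitingTime_pos h2).monotone with h | ⟨l, hl⟩
  · exact h
  · exfalso
    have hd : Tendsto (fun j => T (j + 1) ω - T j ω) atTop (𝓝 0) := by
      simpa using ((tendsto_add_atTop_iff_nat 1).2 hl).sub hl
    have hw : ∀ᶠ j in atTop, waitingTime T j ω < 1 :=
      ((tendsto_add_atTop_iff_nat (f := fun j => waitingTime T j ω) 1).1 hd).eventually
        (gt_mem_nhds one_pos)
    rw [mem_limsup_iff_frequently_mem] at h1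
    obtain ⟨j, hj1, hj2⟩ := (h1.and_eventually hw).exists
    exact lt_asymm hj1 hj2

end Epochs

/-! ### The exponential functional, its renewal equation and the martingale -/

section Renewal

lemma norm_cexp_sub_cexp_le_of_re_nonpos {a b : ℂ} (ha : a.re ≤ 0) (hb : b.re ≤ 0) :
    ‖Complex.exp a - Complex.exp b‖ ≤ ‖a - b‖ := by
  have := (convex_halfSpace_re_le 0).norm_image_sub_le_of_norm_hasDerivWithin_le (C := 1)
    (f := Complex.exp) (f' := Complex.exp) (x := b) (y := a) (𝕜 := ℂ)
    (fun z _ => (Complex.hasDerivAt_exp z).hasDerivWithinAt)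
    (fun z hz => by rw [Complex.norm_exp]; exact Real.exp_le_one_iff.2 hz) hb ha
  simpa using this

/-- The exponential functional `exp (r ∫_s^M (f - 1))`. -/
noncomputable def expFunctional (r M : ℝ) (f : ℝ → ℂ) (s : ℝ) : ℂ :=
  Complex.exp (r * ∫ u in s..M, (f u - 1))

variable {r M : ℝ} {f : ℝ → ℂ}

lemma intervalIntegrable_sub_one (hf : Measurable f) (hf1 : ∀ u, ‖f u‖ ≤ 1) (a b : ℝ) :
    IntervalIntegrable (fun u => f u - 1) volume a b := by
  refine (intervalIntegrable_const (c := (2 : ℝ))).mono_fun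
    (hf.sub_const 1).aestronglyMeasurable (ae_of_all _ fun u => ?_)
  calc ‖f u - 1‖ ≤ ‖f u‖ + ‖(1 : ℂ)‖ := norm_sub_le _ _
    _ ≤ ‖(2 : ℝ)‖ := by simp; linarith [hf1 u]

lemma expFunctional_of_ge (hfM : ∀ u, M < u → f u = 1) {s : ℝ} (hs : M ≤ s) :
    expFunctional r M f s = 1 := by
  rw [expFunctional, intervalIntegral.integral_symm, intervalIntegral.integral_of_le hs,
    setIntegral_congr_fun (g := fun _ => 0) measurableSet_Ioc (fun u hu => by simp [hfM u hu.1])]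
  simp

/-- Since `‖f‖ ≤ 1`, `Re (f - 1) ≤ 0`, and beyond `M` the integrand vanishes. This is what bounds
the exponential functional by `1`. -/
lemma re_integral_sub_one_nonpos (hf1 : ∀ u, ‖f u‖ ≤ 1) (hf : Measurable f)
    (hfM : ∀ u, M < u → f u = 1) (s : ℝ) : (∫ u in s..M, (f u - 1)).re ≤ 0 := by
  rcases le_total s M with h | h
  · rw [intervalIntegral.integral_of_le h]
    have hi := ((intervalIntegrable_iff_integrableOn_Ioc_of_le h).1
      (intervalIntegrable_sub_one hf hf1 s M))
    have := integral_re hi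
    rw [← RCLike.re_eq_complex_re, ← this]
    refine integral_nonpos fun u => ?_
    have h1 := (Complex.re_le_norm (f u)).trans (hf1 u)
    simpa using h1
  · rw [intervalIntegral.integral_symm, intervalIntegral.integral_of_le h,
      setIntegral_congr_fun (g := fun _ => 0) measurableSet_Ioc (fun u hu => by simp [hfM u hu.1])]
    simp

lemma norm_expFunctional_le (hr : 0 < r) (hf1 : ∀ u, ‖f u‖ ≤ 1) (hf : Measurable f)
    (hfM : ∀ u, M < u → f u = 1) (s : ℝ) : ‖expFunctional r M f s‖ ≤ 1 := by
  rw [expFunctional, Complex.norm_exp, Real.exp_le_one_iff, Complex.re_ofReal_mul]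
  exact mul_nonpos_of_nonneg_of_nonpos hr.le (re_integral_sub_one_nonpos hf1 hf hfM s)

lemma continuous_expFunctional (hf1 : ∀ u, ‖f u‖ ≤ 1) (hf : Measurable f) :
    Continuous (expFunctional r M f) := by
  unfold expFunctional
  have h : Continuous fun s => ∫ u in s..M, (f u - 1) := by
    simp_rw [intervalIntegral.integral_symm M]
    exact (intervalIntegral.continuous_primitive
      (fun a b => intervalIntegrable_sub_one hf hf1 a b) M).neg
  fun_prop

/-- The renewal equation satisfied by the exponential functional. -/
lemma integral_expMeasure_expFunctional (hr : 0 < r) (hf1 : ∀ u, ‖f u‖ ≤ 1) (hf : Measurable f)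
    (hfM : ∀ u, M < u → f u = 1) (s : ℝ) :
    ∫ x, f (s + x) * expFunctional r M f (s + x) ∂(expMeasure r) = expFunctional r M f s := by
  -- The functional weighted by the exponential tail from `s`. The exponent has derivative `-r (f -
  -- 1) - r = -r f`, so `E' = -r f E` almost everywhere; integrating over `(s, ∞)` gives the claim.
  set E : ℝ → ℂ := fun y => Complex.exp (r * (∫ u in y..M, (f u - 1)) - r * (y - s)) with hE
  have hEeq : ∀ y, E y = Real.exp (-(r * (y - s))) * expFunctional r M f y := fun y => by
    simp only [hE, expFunctional]
    rw [Complex.ofReal_exp, ← Complex.exp_add]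
    congr 1; push_cast; ring
  have hEs : E s = expFunctional r M f s := by simp [hEeq]
  have hre : ∀ y, s ≤ y → (r * (∫ u in y..M, (f u - 1)) - r * (y - s) : ℂ).re ≤ 0 := fun y hy => by
    have h1 := re_integral_sub_one_nonpos hf1 hf hfM y
    have h2 : (r * (∫ u in y..M, (f u - 1)) - r * (y - s) : ℂ).re =
        r * (∫ u in y..M, (f u - 1)).re - r * (y - s) := by simp
    rw [h2]
    nlinarith
  have hE1 : ∀ y, s ≤ y → ‖E y‖ ≤ 1 := fun y hy => by
    simp only [hE]
    rw [Complex.norm_exp, Real.exp_le_one_iff]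
    exact hre y hy
  have hEc : Continuous E := by
    have h : E = fun y => (Real.exp (-(r * (y - s))) : ℂ) * expFunctional r M f y := funext hEeq
    rw [h]
    exact (by fun_prop : Continuous fun y : ℝ => (Real.exp (-(r * (y - s))) : ℂ)).mul
      (continuous_expFunctional hf1 hf)
  have hi := intervalIntegrable_sub_one hf hf1
  have hfi : ∀ a b, IntervalIntegrable (fun z => r * (f z * E z)) volume a b := fun a b => by
    have h1 : IntervalIntegrable f volume a b := by
      simpa using (hi a b).add (intervalIntegrable_const (c := (1 : ℂ)))
    exact (h1.mul_continuousOn hEc.continuousOn).const_mul _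
  have hdiff : ∀ y z, (∫ u in y..M, (f u - 1)) - (∫ u in z..M, (f u - 1)) =
      ∫ u in y..z, (f u - 1) := fun y z => by
    rw [sub_eq_iff_eq_add, intervalIntegral.integral_add_adjacent_intervals (hi _ _) (hi _ _)]
  -- As `f` is only measurable, the derivative exists only almost everywhere. Both summands are
  -- Lipschitz, hence absolutely continuous, which makes an almost everywhere zero derivative
  -- sufficient.
  have hconst : ∀ b, s ≤ b → E b + ∫ z in s..b, r * (f z * E z) = E s := by
    intro b hb
    set N : ℝ → ℂ := fun y => E y + ∫ z in s..y, r * (f z * E z) with hN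
    have hac1 : AbsolutelyContinuousOnInterval E s b := by
      refine LipschitzOnWith.absolutelyContinuousOnInterval (K := (3 * r).toNNReal) ?_
      rw [Set.uIcc_of_le hb]
      refine LipschitzOnWith.of_dist_le_mul fun y hy z hz => ?_
      rw [dist_eq_norm, dist_eq_norm, Real.coe_toNNReal _ (by positivity)]
      refine (norm_cexp_sub_cexp_le_of_re_nonpos (hre y hy.1) (hre z hz.1)).trans ?_
      have h1 : (r * (∫ u in y..M, (f u - 1)) - r * (y - s) : ℂ) -
          (r * (∫ u in z..M, (f u - 1)) - r * (z - s)) =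
          r * (∫ u in y..z, (f u - 1)) - r * ((y - z : ℝ) : ℂ) := by
        rw [← hdiff y z]; push_cast; ring
      rw [h1]
      have h2 : ‖∫ u in y..z, (f u - 1)‖ ≤ 2 * |z - y| :=
        intervalIntegral.norm_integral_le_of_norm_le_const fun u _ => by
          calc ‖f u - 1‖ ≤ ‖f u‖ + ‖(1 : ℂ)‖ := norm_sub_le _ _
            _ ≤ 2 := by simp; linarith [hf1 u]
      calc _ ≤ ‖(r : ℂ) * ∫ u in y..z, (f u - 1)‖ + ‖(r : ℂ) * ((y - z : ℝ) : ℂ)‖ := norm_sub_le _ _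
        _ = r * ‖∫ u in y..z, (f u - 1)‖ + r * |y - z| := by
            rw [norm_mul, norm_mul, Complex.norm_real, Complex.norm_real, Real.norm_of_nonneg hr.le,
              Real.norm_eq_abs]
        _ ≤ r * (2 * |z - y|) + r * |y - z| := by gcongr
        _ = 3 * r * ‖y - z‖ := by rw [Real.norm_eq_abs, abs_sub_comm z y]; ring
    have hac2 : AbsolutelyContinuousOnInterval (fun y => ∫ z in s..y, r * (f z * E z)) s b := by
      refine LipschitzOnWith.absolutelyContinuousOnInterval (K := r.toNNReal) ?_
      rw [Set.uIcc_of_le hb]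
      refine LipschitzOnWith.of_dist_le_mul fun y hy z hz => ?_
      rw [dist_eq_norm, dist_eq_norm, Real.coe_toNNReal _ hr.le,
        intervalIntegral.integral_interval_sub_left (hfi _ _) (hfi _ _), Real.norm_eq_abs]
      refine intervalIntegral.norm_integral_le_of_norm_le_const fun u hu => ?_
      have hu' : s ≤ u := by
        rcases Set.mem_uIoc.1 hu with h | h
        · exact hz.1.trans h.1.le
        · exact hy.1.trans h.1.le
      rw [norm_mul, norm_mul, Complex.norm_real, Real.norm_of_nonneg hr.le]
      calc r * (‖f u‖ * ‖E u‖) ≤ r * (1 * 1) := by gcongr; exacts [hf1 u, hE1 u hu']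
        _ = r := by ring
    have hd : ∀ᵐ x, x ∈ Set.uIcc s b → HasDerivAt N 0 x := by
      filter_upwards [(hi s b).ae_hasDerivAt_integral, (hfi s b).ae_hasDerivAt_integral]
        with x h1 h2 hx
      have h1 := h1 hx s Set.left_mem_uIcc
      have h2 := h2 hx s Set.left_mem_uIcc
      have h3 : HasDerivAt (fun y => ∫ u in y..M, (f u - 1)) (-(f x - 1)) x := by
        have h4 : (fun y => ∫ u in y..M, (f u - 1)) =
            fun y => (∫ u in s..M, (f u - 1)) - ∫ u in s..y, (f u - 1) := by
          ext y; rw [← hdiff s y]; ring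
        rw [h4]
        exact h1.const_sub _
      have h5 : HasDerivAt (fun y : ℝ => (r : ℂ) * ((y : ℂ) - s)) (r * 1) x :=
        ((Complex.ofRealCLM.hasDerivAt (x := x)).sub_const (s : ℂ)).const_mul (r : ℂ)
      refine (((h3.const_mul (r : ℂ)).sub h5).cexp.add h2).congr_deriv ?_
      simp only [hE, Pi.sub_apply]
      ring
    obtain ⟨C, hC⟩ := (hac1.add hac2).const_of_ae_hasDerivAt_zero hd
    have h1 := hC s Set.left_mem_uIcc
    have h2 := hC b Set.right_mem_uIcc
    simp only [Pi.add_apply] at h1 h2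
    rw [h2, ← h1]; simp
  have hEdecay : ∀ y, ‖E y‖ ≤ Real.exp (-(r * (y - s))) := fun y => by
    rw [hEeq, norm_mul, Complex.norm_real, Real.norm_of_nonneg (Real.exp_pos _).le]
    exact mul_le_of_le_one_right (Real.exp_pos _).le (norm_expFunctional_le hr hf1 hf hfM y)
  have hexp0 : Tendsto (fun y => Real.exp (-(r * (y - s)))) atTop (𝓝 0) :=
    Real.tendsto_exp_neg_atTop_nhds_zero.comp
      ((tendsto_atTop_add_const_right _ (-s) tendsto_id).const_mul_atTop hr)
  have hE0 : Tendsto E atTop (𝓝 0) := squeeze_zero_norm hEdecay hexp0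
  have hint : IntegrableOn (fun z => r * (f z * E z)) (Set.Ioi s) := by
    have h1 : IntegrableOn (fun z => r * Real.exp (r * s) * Real.exp (-r * z)) (Set.Ioi s) :=
      (exp_neg_integrableOn_Ioi s hr).const_mul _
    refine Integrable.mono' h1 ?_ (ae_of_all _ fun z => ?_)
    · exact (measurable_const.mul (hf.mul hEc.measurable)).aestronglyMeasurable
    · rw [norm_mul, norm_mul, Complex.norm_real, Real.norm_of_nonneg hr.le, mul_assoc,
        ← Real.exp_add]
      have h2 : ‖f z‖ * ‖E z‖ ≤ 1 * Real.exp (-(r * (z - s))) := by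
        gcongr
        exacts [hf1 z, hEdecay z]
      rw [one_mul, show -(r * (z - s)) = r * s + -r * z by ring] at h2
      gcongr
  have hlim1 := intervalIntegral_tendsto_integral_Ioi s hint tendsto_id
  have hlim2 : Tendsto (fun b => ∫ z in s..b, r * (f z * E z)) atTop (𝓝 (E s)) := by
    have h1 : Tendsto (fun b => E s - E b) atTop (𝓝 (E s - 0)) := tendsto_const_nhds.sub hE0
    rw [sub_zero] at h1
    refine h1.congr' ?_
    filter_upwards [eventually_ge_atTop s] with b hb
    rw [← hconst b hb]; ring
  have hfinal := tendsto_nhds_unique hlim1 hlim2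
  rw [integral_expMeasure hr, ← hEs, ← hfinal]
  have hshift : ∫ x in Set.Ioi 0, r * (f (s + x) * E (s + x)) =
      ∫ z in Set.Ioi s, r * (f z * E z) := by
    have h := (measurePreserving_add_left volume s).setIntegral_preimage_emb
      (measurableEmbedding_addLeft s) (fun z => r * (f z * E z)) (Set.Ioi s)
    rwa [Set.preimage_const_add_Ioi, sub_self] at h
  rw [← hshift]
  refine setIntegral_congr_fun measurableSet_Ioi fun x _ => ?_
  simp only [hEeq, Complex.real_smul]
  rw [add_sub_cancel_left]
  push_cast
  ring

end Renewal

section Martingale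

variable {Ω : Type*} [MeasurableSpace Ω] {P : Measure Ω} {r M : ℝ}
  {T : ℕ → Ω → ℝ} {f : ℝ → ℂ}

/-- The product `∏_{j ≤ n} f (T j)` together with `T n` is independent of the next waiting time. -/
lemma IsPoissonEpochs.indepFun_prod_waitingTime (hT : IsPoissonEpochs r T P) (hf : Measurable f)
    (n : ℕ) :
    IndepFun (fun ω => (∏ j ∈ Finset.range (n + 1), f (T j ω), T n ω)) (waitingTime T (n + 1)) P := by
  have hind := hT.iIndepFun.indepFun_finset (Finset.range (n + 1)) {n + 1} (by simp)
    hT.measurable_waitingTime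
  -- `S j` rebuilds `T j` from the first `n + 1` waiting times; the default `0` is never used for `j
  -- ≤ n`.
  set S : ℕ → (Finset.range (n + 1) → ℝ) → ℝ := fun j x =>
    ∑ i ∈ Finset.range (j + 1), if h : i ∈ Finset.range (n + 1) then x ⟨i, h⟩ else 0 with hS
  have hSm : ∀ j, Measurable (S j) := fun j => by
    refine Finset.measurable_sum _ fun i _ => ?_
    split_ifs with h
    · exact measurable_pi_apply _
    · exact measurable_const
  have hST : ∀ j ≤ n, ∀ ω, S j (fun i => waitingTime T i ω) = T j ω := fun j hj ω => by
    rw [← sum_waitingTime (T := T)]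
    refine Finset.sum_congr rfl fun i hi => ?_
    rw [dif_pos]
    rw [Finset.mem_range] at hi ⊢
    omega
  have hψm : Measurable fun x : ({n + 1} : Finset ℕ) → ℝ =>
      x ⟨n + 1, Finset.mem_singleton_self _⟩ := measurable_pi_apply _
  have hcomp := hind.comp (φ := fun x => (∏ j ∈ Finset.range (n + 1), f (S j x), S n x))
    (ψ := fun x : ({n + 1} : Finset ℕ) → ℝ => x ⟨n + 1, Finset.mem_singleton_self _⟩)
    ((Finset.measurable_prod _ fun j _ => hf.comp (hSm j)).prodMk (hSm n)) hψm
  convert hcomp using 1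
  · ext ω
    · simp only [Function.comp]
      refine Finset.prod_congr rfl fun j hj => ?_
      rw [hST j (by rw [Finset.mem_range] at hj; omega)]
    · simp only [Function.comp]
      rw [hST n le_rfl]
  · rfl

lemma norm_prod_le_one {ι : Type*} {s : Finset ι} {g : ι → ℂ} (h : ∀ i ∈ s, ‖g i‖ ≤ 1) :
    ‖∏ i ∈ s, g i‖ ≤ 1 := by
  rw [norm_prod]
  exact Finset.prod_le_one (fun _ _ => norm_nonneg _) h

/-- The exponential functional turns products along the epochs into a martingale. -/
lemma IsPoissonEpochs.integral_prod_mul_expFunctional [IsProbabilityMeasure P]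
    (hT : IsPoissonEpochs r T P) (hr : 0 < r)
    (hf1 : ∀ u, ‖f u‖ ≤ 1) (hf : Measurable f) (hfM : ∀ u, M < u → f u = 1) (n : ℕ) :
    ∫ ω, (∏ j ∈ Finset.range (n + 1), f (T j ω)) * expFunctional r M f (T n ω) ∂P =
      expFunctional r M f 0 := by
  have hgm : Measurable (expFunctional r M f) := (continuous_expFunctional hf1 hf).measurable
  have hg1 := norm_expFunctional_le hr hf1 hf hfM
  have hexp := isProbabilityMeasure_expMeasure hr
  induction n with
  | zero =>
    rw [← integral_expMeasure_expFunctional hr hf1 hf hfM 0, ← (hT.hasLaw 0).map_eq,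
      integral_map (hT.measurable_waitingTime 0).aemeasurable]
    · simp [waitingTime]
    · exact ((hf.comp (measurable_const_add 0)).mul
        (hgm.comp (measurable_const_add 0))).aestronglyMeasurable
  | succ n ih =>
    set A : Ω → ℂ := fun ω => ∏ j ∈ Finset.range (n + 1), f (T j ω) with hA
    have hAm : Measurable A := Finset.measurable_prod _ fun j _ => hf.comp (hT.measurable j)
    set W := waitingTime T (n + 1) with hW
    have hWm : Measurable W := hT.measurable_waitingTime _
    have hind : IndepFun (fun ω => (A ω, T n ω)) W P := hT.indepFun_prod_waitingTime hf n
    have hpm : Measurable fun ω => (A ω, T n ω) := hAm.prodMk (hT.measurable n)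
    have hmap := (indepFun_iff_map_prod_eq_prod_map_map hpm.aemeasurable hWm.aemeasurable).1 hind
    rw [(hT.hasLaw (n + 1)).map_eq] at hmap
    set k : ℝ → ℂ := fun u => f u * expFunctional r M f u with hk
    have hkm : Measurable k := hf.mul hgm
    have hk1 : ∀ u, ‖k u‖ ≤ 1 := fun u => by
      rw [hk, norm_mul]; exact mul_le_one₀ (hf1 u) (norm_nonneg _) (hg1 u)
    have hA1 : ∀ ω, ‖A ω‖ ≤ 1 := fun ω => norm_prod_le_one fun j _ => hf1 _
    -- The next epoch is `T n + W` with `W` independent of the past, so integrating `W` out first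
    -- reduces step `n + 1` to step `n` by the renewal equation.
    set Φ : (ℂ × ℝ) × ℝ → ℂ := fun z => z.1.1 * k (z.1.2 + z.2) with hΦ
    have hΦm : Measurable Φ := by
      have := hkm.comp ((measurable_snd.comp measurable_fst).add measurable_snd :
        Measurable fun z : (ℂ × ℝ) × ℝ => z.1.2 + z.2)
      exact (measurable_fst.comp measurable_fst).mul this
    have hΦi : Integrable Φ ((P.map fun ω => (A ω, T n ω)).prod (expMeasure r)) := by
      rw [← hmap, integrable_map_measure hΦm.aestronglyMeasurable (hpm.prodMk hWm).aemeasurable]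
      refine Integrable.mono' (integrable_const (1 : ℝ))
        (hΦm.comp (hpm.prodMk hWm)).aestronglyMeasurable (ae_of_all _ fun ω => ?_)
      simp only [hΦ, Function.comp]
      rw [norm_mul]; exact mul_le_one₀ (hA1 ω) (norm_nonneg _) (hk1 _)
    calc ∫ ω, (∏ j ∈ Finset.range (n + 1 + 1), f (T j ω)) * expFunctional r M f (T (n + 1) ω) ∂P
        = ∫ ω, Φ ((A ω, T n ω), W ω) ∂P := by
          congr 1; ext ω
          have h1 : T n ω + W ω = T (n + 1) ω := by simp [hW, waitingTime]
          simp only [hΦ, hk, h1]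
          rw [Finset.prod_range_succ, mul_assoc]
      _ = ∫ z, Φ z ∂((P.map fun ω => (A ω, T n ω)).prod (expMeasure r)) := by
          rw [← hmap, integral_map (hpm.prodMk hWm).aemeasurable hΦm.aestronglyMeasurable]
      _ = ∫ p, ∫ x, Φ (p, x) ∂(expMeasure r) ∂(P.map fun ω => (A ω, T n ω)) := by
          rw [integral_prod _ hΦi]
      _ = ∫ p, p.1 * expFunctional r M f p.2 ∂(P.map fun ω => (A ω, T n ω)) := by
          congr 1; ext p
          simp only [hΦ, hk]
          rw [integral_const_mul, integral_expMeasure_expFunctional hr hf1 hf hfM]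
      _ = _ := by
          have hm : Measurable fun p : ℂ × ℝ => p.1 * expFunctional r M f p.2 :=
            measurable_fst.mul (hgm.comp measurable_snd)
          rw [integral_map hpm.aemeasurable hm.aestronglyMeasurable, ← ih]

end Martingale

/-! ### Joint law of epochs and noises -/

section Noise

variable {Ω : Type*} [MeasurableSpace Ω] {P : Measure Ω} [IsProbabilityMeasure P]
  {T R : ℕ → Ω → ℝ} {F : Kernel ℝ ℝ} [IsMarkovKernel F]

/-- The conditional law of the first `n` noises given the epochs. -/
noncomputable def noiseKernel (F : Kernel ℝ ℝ) [IsMarkovKernel F] (n : ℕ) :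
    Kernel (ℕ → ℝ) (Fin n → ℝ) where
  toFun t := Measure.pi fun j => F (t j)
  measurable' := by
    refine Measurable.measure_of_isPiSystem_of_isProbabilityMeasure generateFrom_pi.symm
      isPiSystem_pi ?_
    rintro _ ⟨A, hA, rfl⟩
    simp only [Measure.pi_pi]
    refine Finset.measurable_prod _ fun j _ => ?_
    exact (F.measurable_coe (hA j (Set.mem_univ j))).comp (measurable_pi_apply _)

lemma noiseKernel_apply (n : ℕ) (t : ℕ → ℝ) :
    noiseKernel F n t = Measure.pi fun j : Fin n => F (t j) := rfl

instance (n : ℕ) : IsMarkovKernel (noiseKernel F n) :=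
  ⟨fun t => by rw [noiseKernel_apply]; infer_instance⟩

/-- The joint law of the epochs and of the first `n` noises. -/
lemma IsNoiseGivenEpochs.map_prod_eq_compProd (hTm : ∀ j, Measurable (T j))
    (hR : IsNoiseGivenEpochs F T R P) (n : ℕ) :
    P.map (fun ω => ((fun j => T j ω : ℕ → ℝ), (fun j => R j ω : Fin n → ℝ))) =
      (P.map fun ω j => T j ω) ⊗ₘ noiseKernel F n := by
  set τ : Ω → ℕ → ℝ := fun ω j => T j ω with hτ
  set ρ : Ω → Fin n → ℝ := fun ω j => R j ω with hρ
  have hτm : Measurable τ := measurable_pi_lambda _ hTm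
  have hρm : Measurable ρ := measurable_pi_lambda _ fun j => hR.measurable j
  have hPτ : IsProbabilityMeasure (P.map τ) := Measure.isProbabilityMeasure_map hτm.aemeasurable
  have hPτρ : IsProbabilityMeasure (P.map fun ω => (τ ω, ρ ω)) :=
    Measure.isProbabilityMeasure_map (hτm.prodMk hρm).aemeasurable
  refine Measure.ext_prod fun {B A} hB hA => ?_
  -- For fixed `B` both sides are finite measures in `A`. The conditional probabilities are
  -- prescribed on rectangles, a π-system that generates the σ-algebra.
  set ν₁ : Measure (Fin n → ℝ) := (P.restrict (τ ⁻¹' B)).map ρ with hν₁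
  set ν₂ : Measure (Fin n → ℝ) := ((P.map τ).restrict B).bind (noiseKernel F n) with hν₂
  have h1 : ∀ A, MeasurableSet A → ν₁ A = P (τ ⁻¹' B ∩ ρ ⁻¹' A) := fun A hA => by
    rw [hν₁, Measure.map_apply hρm hA, Measure.restrict_apply (hρm hA), Set.inter_comm]
  have h2 : ∀ A, MeasurableSet A → ν₂ A = ∫⁻ t in B, noiseKernel F n t A ∂(P.map τ) :=
    fun A hA => by rw [hν₂, Measure.bind_apply hA (Kernel.aemeasurable _)]
  have hpi : ∀ A : Fin n → Set ℝ, (∀ j, MeasurableSet (A j)) →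
      ν₁ (Set.univ.pi A) = ν₂ (Set.univ.pi A) := by
    intro A hA
    have hAm : MeasurableSet (Set.univ.pi A) := MeasurableSet.univ_pi hA
    rw [h1 _ hAm, h2 _ hAm, setLIntegral_map hB (Kernel.measurable_coe _ hAm) hτm]
    set A' : ℕ → Set ℝ := fun j => if h : j < n then A ⟨j, h⟩ else Set.univ with hA'
    have hA'm : ∀ j, MeasurableSet (A' j) := fun j => by
      simp only [hA']; split_ifs
      exacts [hA _, MeasurableSet.univ]
    have hE : ⋂ j ∈ Finset.range n, R j ⁻¹' A' j = ρ ⁻¹' Set.univ.pi A := by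
      ext ω
      simp only [Set.mem_iInter, Finset.mem_range, Set.mem_preimage, Set.mem_univ_pi, hρ]
      constructor
      · intro h j
        simpa [hA'] using h j j.2
      · intro h j hj
        simpa [hA', hj] using h ⟨j, hj⟩
    have hcond := hR.condProb_eq (Finset.range n) A' hA'm
    rw [hE] at hcond
    have hm : MeasurableSpace.comap τ inferInstance ≤ ‹MeasurableSpace Ω› := hτm.comap_le
    have hset := setIntegral_condExp hm (μ := P)
      (f := (ρ ⁻¹' Set.univ.pi A).indicator fun _ => (1 : ℝ))
      ((integrable_const (1 : ℝ)).indicator (hρm hAm)) (s := τ ⁻¹' B) ⟨B, hB, rfl⟩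
    rw [setIntegral_congr_ae (g := fun ω => ∏ j ∈ Finset.range n, (F (T j ω)).real (A' j))
      (hτm hB) (hcond.mono fun ω h _ => h), integral_indicator (hρm hAm),
      Measure.restrict_restrict (hρm hAm), setIntegral_const, smul_eq_mul, mul_one] at hset
    have hprod : ∀ ω, ∏ j ∈ Finset.range n, (F (T j ω)).real (A' j) =
        (noiseKernel F n (τ ω) (Set.univ.pi A)).toReal := fun ω => by
      rw [noiseKernel_apply, Measure.pi_pi, ENNReal.toReal_prod, Finset.prod_range]
      refine Finset.prod_congr rfl fun j _ => ?_
      simp only [hA', Fin.is_lt, dif_pos]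
      rfl
    simp_rw [hprod] at hset
    have hkm : AEMeasurable (fun ω => noiseKernel F n (τ ω) (Set.univ.pi A))
        (P.restrict (τ ⁻¹' B)) :=
      ((Kernel.measurable_coe (noiseKernel F n) hAm).comp hτm).aemeasurable
    rw [integral_toReal hkm
      (ae_of_all _ fun ω => measure_lt_top _ _), measureReal_def, ENNReal.toReal_eq_toReal_iff'
      _ (measure_ne_top _ _)] at hset
    · rw [hset, Set.inter_comm]
    · refine ne_of_lt ((lintegral_mono (g := fun _ => 1) fun ω => prob_le_one).trans_lt ?_)
      rw [lintegral_one]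
      exact measure_lt_top _ _
  have hfin₁ : IsFiniteMeasure ν₁ := by rw [hν₁]; infer_instance
  have hν : ν₁ = ν₂ := by
    refine ext_of_generate_finite _ generateFrom_pi.symm isPiSystem_pi ?_ ?_
    · rintro _ ⟨A, hA, rfl⟩
      exact hpi A fun j => hA j (Set.mem_univ j)
    · rw [← Set.pi_univ Set.univ]
      exact hpi _ fun _ => MeasurableSet.univ
  rw [Measure.map_apply (hτm.prodMk hρm) (hB.prod hA), Measure.compProd_apply_prod hB hA,
    ← h2 A hA, ← hν, h1 A hA]
  rfl

/-- Averaging over the noises conditionally on the epochs. -/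
lemma IsNoiseGivenEpochs.integral_prod_mul (hTm : ∀ j, Measurable (T j))
    (hR : IsNoiseGivenEpochs F T R P) (n : ℕ) {ψ : ℝ → ℝ → ℂ}
    (hψ : Measurable (Function.uncurry ψ)) (hψ1 : ∀ u x, ‖ψ u x‖ ≤ 1) {G : (ℕ → ℝ) → ℂ}
    (hG : Measurable G) (hG1 : ∀ t, ‖G t‖ ≤ 1) :
    ∫ ω, (∏ j ∈ Finset.range n, ψ (T j ω) (R j ω)) * G (fun j => T j ω) ∂P =
      ∫ ω, (∏ j ∈ Finset.range n, ∫ x, ψ (T j ω) x ∂(F (T j ω))) * G (fun j => T j ω) ∂P := by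
  set τ : Ω → ℕ → ℝ := fun ω j => T j ω with hτ
  set ρ : Ω → Fin n → ℝ := fun ω j => R j ω with hρ
  have hτm : Measurable τ := measurable_pi_lambda _ hTm
  have hρm : Measurable ρ := measurable_pi_lambda _ fun j => hR.measurable j
  have hPτ : IsProbabilityMeasure (P.map τ) := Measure.isProbabilityMeasure_map hτm.aemeasurable
  set Φ : (ℕ → ℝ) × (Fin n → ℝ) → ℂ := fun z => (∏ j : Fin n, ψ (z.1 j) (z.2 j)) * G z.1 with hΦ
  have hΦm : Measurable Φ := by
    refine (Finset.measurable_prod _ fun j _ => ?_).mul (hG.comp measurable_fst)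
    have hj : Measurable fun z : (ℕ → ℝ) × (Fin n → ℝ) => (z.1 (j : ℕ), z.2 j) := by fun_prop
    exact hψ.comp hj
  have hlaw := hR.map_prod_eq_compProd hTm n
  have hΦi : Integrable Φ ((P.map τ) ⊗ₘ noiseKernel F n) := by
    refine Integrable.mono' (integrable_const (1 : ℝ)) hΦm.aestronglyMeasurable
      (ae_of_all _ fun z => ?_)
    rw [norm_mul]
    exact mul_le_one₀ (norm_prod_le_one fun _ _ => hψ1 _ _) (norm_nonneg _) (hG1 _)
  have hm : Measurable fun t : ℕ → ℝ => (∏ j ∈ Finset.range n, ∫ x, ψ (t j) x ∂(F (t j))) * G t := by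
    refine (Finset.measurable_prod _ fun j _ => ?_).mul hG
    have : StronglyMeasurable fun u => ∫ x, ψ u x ∂(F u) :=
      hψ.stronglyMeasurable.integral_kernel_prod_right'
    exact this.measurable.comp (measurable_pi_apply j)
  calc _ = ∫ ω, Φ (τ ω, ρ ω) ∂P := by
        congr 1; ext ω
        simp only [hΦ, hτ, hρ]
        rw [Finset.prod_range]
    _ = ∫ z, Φ z ∂((P.map τ) ⊗ₘ noiseKernel F n) := by
        rw [← hlaw, integral_map (hτm.prodMk hρm).aemeasurable hΦm.aestronglyMeasurable]
    _ = ∫ t, ∫ y, Φ (t, y) ∂(noiseKernel F n t) ∂(P.map τ) := Measure.integral_compProd hΦi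
    _ = ∫ t, (∏ j ∈ Finset.range n, ∫ x, ψ (t j) x ∂(F (t j))) * G t ∂(P.map τ) := by
        congr 1; ext t
        simp only [hΦ]
        rw [integral_mul_const, noiseKernel_apply,
          integral_fintype_prod_eq_prod (f := fun (j : Fin n) x => ψ (t j) x), Finset.prod_range]
    _ = _ := by rw [integral_map hτm.aemeasurable hm.aestronglyMeasurable]

end Noise

/-! ### Characteristic functional of the marked Poisson process -/

section Campbell

variable {Ω : Type*} [MeasurableSpace Ω] {P : Measure Ω} [IsProbabilityMeasure P] {r M : ℝ}
  {T R : ℕ → Ω → ℝ} {F : Kernel ℝ ℝ} {h : ℝ → ℝ}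

lemma IsPoissonEpochs.ae_eventually_eq_zero (hT : IsPoissonEpochs r T P) (hr : 0 < r)
    (hM : ∀ u, M < u → h u = 0) :
    ∀ᵐ ω ∂P, ∃ N, ∀ j ≥ N, M < T j ω ∧ h (T j ω) * R j ω = 0 := by
  filter_upwards [hT.ae_tendsto_atTop hr] with ω hω
  obtain ⟨N, hN⟩ := eventually_atTop.1 (hω.eventually_gt_atTop M)
  exact ⟨N, fun j hj => ⟨hN j hj, by rw [hM _ (hN j hj), zero_mul]⟩⟩

lemma summable_of_eventually_eq_zero {g : ℕ → ℝ} {N : ℕ} (hg : ∀ j ≥ N, g j = 0) : Summable g :=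
  summable_of_ne_finset_zero (s := Finset.range N) fun j hj => hg j (by simpa using hj)

lemma tsum_eq_sum_range_of_eventually_eq_zero {g : ℕ → ℝ} {N n : ℕ} (hg : ∀ j ≥ N, g j = 0)
    (hn : N ≤ n) : ∑' j, g j = ∑ j ∈ Finset.range n, g j :=
  tsum_eq_sum fun j hj => hg j (hn.trans (by simpa using hj))

lemma IsPoissonEpochs.ae_tendsto_sum (hT : IsPoissonEpochs r T P) (hr : 0 < r)
    (hM : ∀ u, M < u → h u = 0) :
    ∀ᵐ ω ∂P, Tendsto (fun n => ∑ j ∈ Finset.range n, h (T j ω) * R j ω) atTop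
      (𝓝 (∑' j, h (T j ω) * R j ω)) := by
  filter_upwards [hT.ae_eventually_eq_zero (R := R) hr hM] with ω ⟨N, hN⟩
  refine tendsto_const_nhds.congr' ?_
  filter_upwards [eventually_ge_atTop N] with n hn
  exact tsum_eq_sum_range_of_eventually_eq_zero (fun j hj => (hN j hj).2) hn

lemma IsPoissonEpochs.aemeasurable_tsum (hT : IsPoissonEpochs r T P) (hr : 0 < r)
    (hR : ∀ j, Measurable (R j)) (hh : Measurable h) (hM : ∀ u, M < u → h u = 0) :
    AEMeasurable (fun ω => ∑' j, h (T j ω) * R j ω) P :=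
  aemeasurable_of_tendsto_metrizable_ae atTop
    (fun n => (Finset.measurable_sum (Finset.range n) fun j _ =>
      (hh.comp (hT.measurable j)).mul (hR j)).aemeasurable)
    (hT.ae_tendsto_sum hr hM)

/-- The characteristic functional of a marked Poisson process. -/
lemma IsNoiseGivenEpochs.integral_cexp_tsum [IsMarkovKernel F] (hT : IsPoissonEpochs r T P)
    (hr : 0 < r) (hR : IsNoiseGivenEpochs F T R P) (hh : Measurable h)
    (hM : ∀ u, M < u → h u = 0) :
    ∫ ω, Complex.exp ((∑' j, h (T j ω) * R j ω : ℝ) * Complex.I) ∂P =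
      Complex.exp (r * ∫ u in (0 : ℝ)..M,
        (∫ x, Complex.exp ((h u * x : ℝ) * Complex.I) ∂(F u) - 1)) := by
  set ψ : ℝ → ℝ → ℂ := fun u x => Complex.exp ((h u * x : ℝ) * Complex.I) with hψ
  have hψm : Measurable (Function.uncurry ψ) := by
    have : Measurable fun z : ℝ × ℝ => h z.1 * z.2 := (hh.comp measurable_fst).mul measurable_snd
    exact Complex.measurable_exp.comp ((Complex.measurable_ofReal.comp this).mul_const _)
  have hψ1 : ∀ u x, ‖ψ u x‖ ≤ 1 := fun u x => by
    simp only [hψ]; rw [Complex.norm_exp_ofReal_mul_I]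
  set f : ℝ → ℂ := fun u => ∫ x, ψ u x ∂(F u) with hf
  have hfm : Measurable f := by
    have : StronglyMeasurable f := hψm.stronglyMeasurable.integral_kernel_prod_right'
    exact this.measurable
  have hf1 : ∀ u, ‖f u‖ ≤ 1 := fun u => by
    refine (norm_integral_le_of_norm_le_const (ae_of_all _ (hψ1 u))).trans ?_
    simp
  have hfM : ∀ u, M < u → f u = 1 := fun u hu => by simp [hf, hψ, hM u hu]
  have hgc := continuous_expFunctional (r := r) (M := M) hf1 hfm
  have hg1 := norm_expFunctional_le hr hf1 hfm hfM
  have key : ∀ n, ∫ ω, (∏ j ∈ Finset.range (n + 1), ψ (T j ω) (R j ω)) *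
      expFunctional r M f (T n ω) ∂P = expFunctional r M f 0 := fun n => by
    rw [← hT.integral_prod_mul_expFunctional hr hf1 hfm hfM n]
    exact hR.integral_prod_mul hT.measurable (n + 1) hψm hψ1
      (G := fun t => expFunctional r M f (t n))
      (hgc.measurable.comp (measurable_pi_apply n)) fun t => hg1 _
  -- Once `T n` and all later epochs exceed `M`, the exponential functional equals `1` and the
  -- product is already the exponential of the whole series.
  have hlim : Tendsto (fun n => ∫ ω, (∏ j ∈ Finset.range (n + 1), ψ (T j ω) (R j ω)) *
      expFunctional r M f (T n ω) ∂P) atTop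
      (𝓝 (∫ ω, Complex.exp ((∑' j, h (T j ω) * R j ω : ℝ) * Complex.I) ∂P)) := by
    refine tendsto_integral_of_dominated_convergence (fun _ => 1) (fun n => ?_)
      (integrable_const _) (fun n => ae_of_all _ fun ω => ?_) ?_
    · refine (Measurable.mul ?_ (hgc.measurable.comp (hT.measurable n))).aestronglyMeasurable
      exact Finset.measurable_prod _ fun j _ =>
        hψm.comp ((hT.measurable j).prodMk (hR.measurable j))
    · rw [norm_mul]
      exact mul_le_one₀ (norm_prod_le_one fun _ _ => hψ1 _ _) (norm_nonneg _) (hg1 _)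
    · filter_upwards [hT.ae_eventually_eq_zero (R := R) hr hM] with ω ⟨N, hN⟩
      refine tendsto_const_nhds.congr' ?_
      filter_upwards [eventually_ge_atTop N] with n hn
      rw [expFunctional_of_ge hfM (hN n hn).1.le, mul_one, ← Complex.exp_sum, ← Finset.sum_mul,
        tsum_eq_sum_range_of_eventually_eq_zero (fun j hj => (hN j hj).2) (hn.trans n.le_succ),
        Complex.ofReal_sum]
  have := tendsto_nhds_unique (hlim.congr key) tendsto_const_nhds
  rw [this]; rfl

end Campbell

/-! ### Characteristic function of the scaled shot noise -/

section ShotNoise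

variable {Ω : Type*} [MeasurableSpace Ω] {P : Measure Ω} [IsProbabilityMeasure P] {α r K : ℝ}
  {T R : ℕ → Ω → ℝ} {F : Kernel ℝ ℝ}

/-- The maximum with `0` covers negative `t`: convergence in distribution requires measurability for
every real `c`, so `c t` may be negative. -/
lemma response_div_eq_zero_of_max_lt {β : ℝ} (hβ : β ≠ 0) {t u : ℝ} (hu : max t 0 < u) :
    response β (t / u) = 0 :=
  response_div_eq_zero hβ ((le_max_right _ _).trans_lt hu) ((le_max_left _ _).trans_lt hu).le

lemma measurable_response_const_div (β t : ℝ) : Measurable fun u : ℝ => response β (t / u) :=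
  (measurable_response β).comp (measurable_const.div measurable_id)

lemma IsPoissonEpochs.aemeasurable_shotNoise (hT : IsPoissonEpochs r T P) (hr : 0 < r)
    (hR : ∀ j, Measurable (R j)) {β : ℝ} (hβ : β ≠ 0) (t : ℝ) :
    AEMeasurable (shotNoise β T R t) P :=
  hT.aemeasurable_tsum hr hR (M := max t 0) (measurable_response_const_div β t) fun _ hu =>
    response_div_eq_zero_of_max_lt hβ hu

lemma IsPoissonEpochs.aemeasurable_scaledShotNoise (hT : IsPoissonEpochs r T P) (hr : 0 < r)
    (hR : ∀ j, Measurable (R j)) (hα : 1 < α) (c : ℝ) (t : ℝ≥0) :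
    AEMeasurable (scaledShotNoise α r K T R c t) P :=
  (hT.aemeasurable_shotNoise hr hR (by linarith) _).div_const _

/-- The kernel `∑ₜ aₜ (log t - log v)₊ ^ β`. -/
noncomputable def responseSum (β : ℝ) {I : Finset ℝ≥0} (a : I → ℝ) (v : ℝ) : ℝ :=
  ∑ t : I, a t * response β ((t : ℝ≥0) / v)

variable {I : Finset ℝ≥0}

lemma measurable_responseSum (β : ℝ) (a : I → ℝ) : Measurable (responseSum β a) :=
  Finset.measurable_sum _ fun _ _ => (measurable_response_const_div β _).const_mul _

/-- The sum of the times is a convenient upper bound for each of them. -/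
lemma responseSum_eq_zero {β : ℝ} (hβ : β ≠ 0) (a : I → ℝ) {v : ℝ}
    (hv : ((∑ t : I, (t : ℝ≥0) : ℝ≥0) : ℝ) < v) : responseSum β a v = 0 := by
  refine Finset.sum_eq_zero fun t _ => ?_
  rw [response_div_eq_zero hβ ((NNReal.coe_nonneg _).trans_lt hv), mul_zero]
  refine le_trans ?_ hv.le
  exact_mod_cast Finset.single_le_sum (f := fun t : I => (t : ℝ≥0)) (fun _ _ => zero_le)
    (Finset.mem_univ t)

/-- The response depends on `c t / Tⱼ = t / (Tⱼ / c)` only, so scaling moves onto the epochs and the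
combination becomes a single shot noise. Almost surely the series are finite sums, which permits the
interchange. -/
lemma IsPoissonEpochs.ae_sum_scaledShotNoise (hT : IsPoissonEpochs r T P) (hr : 0 < r)
    (hα : 1 < α) (c : ℝ) (a : I → ℝ) :
    ∀ᵐ ω ∂P, ∑ t : I, a t * scaledShotNoise α r K T R c t ω =
      ∑' j, responseSum ((α - 1) / 2) a (T j ω / c) / √(c * (K * r * Real.Gamma α)) * R j ω := by
  have hβ : (α - 1) / 2 ≠ 0 := by linarith
  have h1 : ∀ᵐ ω ∂P, ∀ t : I, ∃ N, ∀ j ≥ N, max (c * t) 0 < T j ω ∧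
      response ((α - 1) / 2) (c * (t : ℝ≥0) / T j ω) * R j ω = 0 :=
    ae_all_iff.2 fun t => hT.ae_eventually_eq_zero (R := R)
      (h := fun u => response ((α - 1) / 2) (c * (t : ℝ≥0) / u)) hr
      fun u hu => response_div_eq_zero_of_max_lt hβ hu
  filter_upwards [h1] with ω hω
  set q := √(c * (K * r * Real.Gamma α)) with hq
  have hs : ∀ t ∈ (Finset.univ : Finset I), Summable fun j =>
      a t / q * (response ((α - 1) / 2) (c * (t : ℝ≥0) / T j ω) * R j ω) := fun t _ => by
    obtain ⟨N, hN⟩ := hω t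
    exact (summable_of_eventually_eq_zero fun j hj => (hN j hj).2).mul_left _
  have h2 : ∀ j, responseSum ((α - 1) / 2) a (T j ω / c) / q * R j ω =
      ∑ t : I, a t / q * (response ((α - 1) / 2) (c * (t : ℝ≥0) / T j ω) * R j ω) := fun j => by
    rw [responseSum, Finset.sum_div, Finset.sum_mul]
    refine Finset.sum_congr rfl fun t _ => ?_
    have : ((t : ℝ≥0) : ℝ) / (T j ω / c) = c * (t : ℝ≥0) / T j ω := by
      rw [div_div_eq_mul_div, mul_comm]
    rw [this]; ring
  simp_rw [h2]
  rw [Summable.tsum_finsetSum hs]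
  refine Finset.sum_congr rfl fun t _ => ?_
  rw [tsum_mul_left, scaledShotNoise, shotNoise, ← hq]
  ring

/-- The characteristic function of linear combinations of the scaled shot noise. -/
lemma IsNoiseGivenEpochs.integral_cexp_sum_scaledShotNoise [IsMarkovKernel F]
    (hT : IsPoissonEpochs r T P) (hr : 0 < r) (hR : IsNoiseGivenEpochs F T R P) (hα : 1 < α)
    {c : ℝ} (hc : 0 < c) (a : I → ℝ) :
    ∫ ω, Complex.exp ((∑ t : I, a t * scaledShotNoise α r K T R c t ω : ℝ) * Complex.I) ∂P =
      Complex.exp (r * ∫ v in Set.Ioi (0 : ℝ), c *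
        (∫ x, Complex.exp ((responseSum ((α - 1) / 2) a v / √(c * (K * r * Real.Gamma α)) * x : ℝ)
          * Complex.I) ∂(F (c * v)) - 1)) := by
  have hβ : (α - 1) / 2 ≠ 0 := by linarith
  set q := √(c * (K * r * Real.Gamma α)) with hq
  set m : ℝ := ((∑ t : I, (t : ℝ≥0) : ℝ≥0) : ℝ) with hm
  have hm0 : 0 ≤ m := NNReal.coe_nonneg _
  rw [integral_congr_ae ((hT.ae_sum_scaledShotNoise (K := K) (R := R) hr hα c a).mono fun ω hω =>
    by simp only [hω]; rfl)]
  have h0 : ∀ u, c * m < u → responseSum ((α - 1) / 2) a (u / c) / q = 0 := fun u hu => by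
    rw [responseSum_eq_zero hβ a ((lt_div_iff₀' hc).2 hu), zero_div]
  have := hR.integral_cexp_tsum hT hr (M := c * m)
    (h := fun u => responseSum ((α - 1) / 2) a (u / c) / q)
    (((measurable_responseSum _ a).comp (measurable_id.div_const c)).div_const q) h0
  rw [this]
  congr 2
  set g : ℝ → ℂ := fun v => ∫ x, Complex.exp ((responseSum ((α - 1) / 2) a v / q * x : ℝ)
          * Complex.I) ∂(F (c * v)) - 1 with hg
  have h3 : ∀ u, ∫ x, Complex.exp ((responseSum ((α - 1) / 2) a (u / c) / q * x : ℝ)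
      * Complex.I) ∂(F u) - 1 = g (u / c) := fun u => by
    simp only [hg]; rw [mul_div_cancel₀ _ hc.ne']
  simp_rw [h3]
  rw [intervalIntegral.integral_comp_div g hc.ne', zero_div, mul_div_cancel_left₀ _ hc.ne',
    intervalIntegral.integral_of_le hm0, integral_const_mul, Complex.real_smul]
  congr 1
  refine (setIntegral_eq_of_subset_of_forall_sdiff_eq_zero measurableSet_Ioi
    Set.Ioc_subset_Ioi_self fun v hv => ?_).symm
  have : m < v := by
    by_contra hlt
    exact hv.2 ⟨hv.1, not_lt.1 hlt⟩
  simp [hg, responseSum_eq_zero hβ a this]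

end ShotNoise

/-! ### Taylor expansion of characteristic functions -/

section Taylor

lemma norm_cexp_sub_one_sub_le (θ : ℝ) :
    ‖Complex.exp (θ * Complex.I) - 1 - θ * Complex.I‖ ≤ 2 * θ ^ 2 := by
  have hn : ‖(θ * Complex.I : ℂ)‖ = |θ| := by simp
  rcases le_total |θ| 1 with h | h
  · have := Complex.norm_exp_sub_one_sub_id_le (x := θ * Complex.I) (by rwa [hn])
    rw [hn, sq_abs] at this
    nlinarith [sq_nonneg θ]
  · have h1 := norm_cexp_sub_cexp_le θ 0
    simp only [Complex.ofReal_zero, zero_mul, Complex.exp_zero, sub_zero] at h1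
    have h2 := norm_sub_le (Complex.exp (θ * Complex.I) - 1) (θ * Complex.I)
    rw [hn] at h2
    nlinarith [sq_abs θ]

lemma norm_cexp_sub_one_sub_add_le (θ : ℝ) :
    ‖Complex.exp (θ * Complex.I) - 1 - θ * Complex.I + (θ ^ 2 / 2 : ℝ)‖ ≤ 3 * |θ| ^ 3 := by
  have hn : ‖(θ * Complex.I : ℂ)‖ = |θ| := by simp
  rcases le_total |θ| 1 with h | h
  · have := Complex.exp_bound (x := θ * Complex.I) (by rwa [hn]) (n := 3) (by norm_num)
    rw [hn] at this
    have h3 : Complex.exp (θ * Complex.I) - 1 - θ * Complex.I + (θ ^ 2 / 2 : ℝ) =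
        Complex.exp (θ * Complex.I) - ∑ m ∈ Finset.range 3, (θ * Complex.I) ^ m / m.factorial := by
      simp [Finset.sum_range_succ, mul_pow]
      ring
    rw [h3]
    refine this.trans ?_
    norm_num [Nat.factorial]
    nlinarith [pow_nonneg (abs_nonneg θ) 3]
  · have h1 := norm_cexp_sub_one_sub_le θ
    have h2 := norm_add_le (Complex.exp (θ * Complex.I) - 1 - θ * Complex.I) (θ ^ 2 / 2 : ℝ)
    rw [Complex.norm_real, Real.norm_of_nonneg (by positivity : 0 ≤ θ ^ 2 / 2)] at h2
    have h4 : θ ^ 2 ≤ |θ| ^ 3 := by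
      rw [← sq_abs]; exact pow_le_pow_right₀ h (by norm_num)
    linarith [pow_nonneg (abs_nonneg θ) 3]

variable {μ : Measure ℝ} [IsProbabilityMeasure μ]

lemma integrable_cexp_const_mul (y : ℝ) :
    Integrable (fun x : ℝ => Complex.exp ((y * x : ℝ) * Complex.I)) μ :=
  integrable_cexp_mul_I (X := fun x => y * x) (by fun_prop)

lemma integrable_cexp_sub_one_sub (h1 : Integrable (fun x : ℝ => x) μ) (y : ℝ) :
    Integrable (fun x : ℝ => Complex.exp ((y * x : ℝ) * Complex.I) - 1 - (y * x : ℝ) * Complex.I)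
      μ :=
  ((integrable_cexp_const_mul y).sub (integrable_const 1)).sub
    ((h1.const_mul y).ofReal.mul_const _)

/-- Centring makes the linear term free, so `φ - 1` is of second order. -/
lemma integral_cexp_sub_one_sub (h1 : Integrable (fun x : ℝ => x) μ) (hm : ∫ x, x ∂μ = 0)
    (y : ℝ) :
    ∫ x, (Complex.exp ((y * x : ℝ) * Complex.I) - 1 - (y * x : ℝ) * Complex.I) ∂μ =
      ∫ x, Complex.exp ((y * x : ℝ) * Complex.I) ∂μ - 1 := by
  have hi : Integrable (fun x : ℝ => ((y * x : ℝ) : ℂ) * Complex.I) μ :=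
    (h1.const_mul y).ofReal.mul_const _
  have hi' : Integrable (fun x : ℝ => Complex.exp ((y * x : ℝ) * Complex.I) - 1) μ :=
    (integrable_cexp_const_mul y).sub (integrable_const 1)
  rw [integral_sub hi' hi,
    integral_sub (integrable_cexp_const_mul y) (integrable_const 1), integral_mul_const,
    integral_complex_ofReal, integral_const_mul, hm]
  simp

/-- First-order expansion of the characteristic function of a centred distribution. -/
lemma norm_integral_cexp_sub_one_le (h1 : Integrable (fun x : ℝ => x) μ) (hm : ∫ x, x ∂μ = 0)
    (h2 : Integrable (fun x : ℝ => x ^ 2) μ) (y : ℝ) :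
    ‖∫ x, Complex.exp ((y * x : ℝ) * Complex.I) ∂μ - 1‖ ≤ 2 * y ^ 2 * ∫ x, x ^ 2 ∂μ := by
  rw [← integral_cexp_sub_one_sub h1 hm, ← integral_const_mul]
  refine norm_integral_le_of_norm_le (h2.const_mul _) (ae_of_all _ fun x => ?_)
  refine (norm_cexp_sub_one_sub_le _).trans_eq ?_
  ring

/-- Second-order expansion of the characteristic function of a centred distribution. -/
lemma norm_integral_cexp_sub_one_add_le (h1 : Integrable (fun x : ℝ => x) μ)
    (hm : ∫ x, x ∂μ = 0) (h2 : Integrable (fun x : ℝ => x ^ 2) μ)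
    (h4 : Integrable (fun x : ℝ => x ^ 4) μ) (y : ℝ) :
    ‖∫ x, Complex.exp ((y * x : ℝ) * Complex.I) ∂μ - 1 + (y ^ 2 / 2 * ∫ x, x ^ 2 ∂μ : ℝ)‖ ≤
      3 * |y| ^ 3 * (∫ x, x ^ 2 ∂μ + ∫ x, x ^ 4 ∂μ) := by
  have hE : ∫ x, Complex.exp ((y * x : ℝ) * Complex.I) ∂μ - 1 + (y ^ 2 / 2 * ∫ x, x ^ 2 ∂μ : ℝ) =
      ∫ x, (Complex.exp ((y * x : ℝ) * Complex.I) - 1 - (y * x : ℝ) * Complex.I +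
        ((y ^ 2 / 2 * x ^ 2 : ℝ) : ℂ)) ∂μ := by
    have hi : Integrable (fun x : ℝ => ((y ^ 2 / 2 * x ^ 2 : ℝ) : ℂ)) μ := (h2.const_mul _).ofReal
    rw [integral_add (integrable_cexp_sub_one_sub h1 y) hi, integral_cexp_sub_one_sub h1 hm, integral_complex_ofReal,
      integral_const_mul]
  rw [hE, ← integral_add h2 h4, ← integral_const_mul]
  refine norm_integral_le_of_norm_le ((h2.add h4).const_mul _) (ae_of_all _ fun x => ?_)
  have h3 := norm_cexp_sub_one_sub_add_le (y * x)
  have h5 : y ^ 2 / 2 * x ^ 2 = (y * x) ^ 2 / 2 := by ring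
  rw [h5]
  refine h3.trans ?_
  rw [abs_mul, mul_pow, ← mul_assoc]
  refine mul_le_mul_of_nonneg_left ?_ (by positivity)
  have h6 : x ^ 4 = |x| ^ 4 := by rw [← abs_pow, abs_of_nonneg (by positivity : 0 ≤ x ^ 4)]
  rw [h6, ← sq_abs]
  -- This is `|x|³ ≤ x² + x⁴`, by which the second and fourth moments control the third-order
  -- remainder.
  nlinarith [sq_nonneg (|x| - 1), sq_nonneg |x|, mul_nonneg (sq_nonneg |x|) (sq_nonneg (|x| - 1))]

end Taylor

/-! ### Convergence of the exponents -/

section Limit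

variable {α r K : ℝ} {F : Kernel ℝ ℝ} [IsMarkovKernel F] {I : Finset ℝ≥0}

lemma integrableOn_responseSum_sq {β : ℝ} (hβ : 0 < β) (a : I → ℝ) :
    IntegrableOn (fun v => responseSum β a v ^ 2) (Set.Ioi 0) := by
  have : MemLp (responseSum β a) 2 (volume.restrict (Set.Ioi 0)) :=
    memLp_finsetSum _ fun t _ => (memLp_response_div hβ t).const_mul (a t)
  exact this.integrable_sq

lemma integral_responseSum_sq (hα : 1 < α ∧ α < 2) (a : I → ℝ) :
    ∫ v in Set.Ioi (0 : ℝ), responseSum ((α - 1) / 2) a v ^ 2 =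
      Real.Gamma α * ∑ s : I, ∑ t : I, a s * a t * hadamardCov α s t := by
  have hβ : 0 < (α - 1) / 2 := by linarith [hα.1]
  have h1 : ∀ v, responseSum ((α - 1) / 2) a v ^ 2 = ∑ s : I, ∑ t : I, a s * a t *
      (response ((α - 1) / 2) ((s : ℝ≥0) / v) * response ((α - 1) / 2) ((t : ℝ≥0) / v)) := fun v => by
    rw [responseSum, sq, Finset.sum_mul_sum]
    exact Finset.sum_congr rfl fun s _ => Finset.sum_congr rfl fun t _ => by ring
  simp_rw [h1]
  have hi : ∀ s t : I, IntegrableOn (fun v : ℝ => a s * a t *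
      (response ((α - 1) / 2) ((s : ℝ≥0) / v) * response ((α - 1) / 2) ((t : ℝ≥0) / v)))
      (Set.Ioi 0) := fun s t => (integrable_response_mul_response hβ s t).const_mul _
  rw [integral_finsetSum _ fun s _ => integrable_finsetSum _ fun t _ => hi s t, Finset.mul_sum]
  refine Finset.sum_congr rfl fun s _ => ?_
  rw [integral_finsetSum _ fun t _ => hi s t, Finset.mul_sum]
  refine Finset.sum_congr rfl fun t _ => ?_
  rw [integral_const_mul, integral_response_mul_response hα]
  ring

/-- Convergence of the exponents of the characteristic functions. -/
lemma tendsto_integral_scaled_charFun_sub_one {η : ℝ → ℝ} (hη : Measurable η)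
    (hη2 : IntegrableOn (fun v => η v ^ 2) (Set.Ioi 0)) {G : ℝ} (hG : 0 < G)
    (hfin : ∀ m ∈ Finset.Icc 1 4, ∀ u : ℝ, 0 < u → Integrable (fun x : ℝ => x ^ m) (F u))
    (hK1 : ∀ u : ℝ, 0 < u → condMoment F 1 u = 0)
    {M₂ M₄ : ℝ} (hK2 : ∀ u : ℝ, 0 < u → condMoment F 2 u ≤ M₂)
    (hK4 : ∀ u : ℝ, 0 < u → condMoment F 4 u ≤ M₄)
    (hK2lim : Tendsto (condMoment F 2) atTop (𝓝 K)) :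
    Tendsto (fun c : ℝ => ∫ v in Set.Ioi (0 : ℝ), c *
        (∫ x, Complex.exp ((η v / √(c * G) * x : ℝ) * Complex.I) ∂(F (c * v)) - 1)) atTop
      (𝓝 (∫ v in Set.Ioi (0 : ℝ), ((-(η v ^ 2 * K / (2 * G)) : ℝ) : ℂ))) := by
  have h1 : ∀ u, 0 < u → Integrable (fun x : ℝ => x) (F u) := fun u hu => by
    simpa using hfin 1 (by simp) u hu
  have hm : ∀ u, 0 < u → ∫ x, x ∂(F u) = 0 := fun u hu => by simpa [condMoment] using hK1 u hu
  have h2 := hfin 2 (by simp)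
  have h4 := hfin 4 (by simp)
  have hsq : ∀ {c : ℝ}, 0 < c → ∀ v, (η v / √(c * G)) ^ 2 = η v ^ 2 / (c * G) := fun hc v => by
    rw [div_pow, Real.sq_sqrt (by positivity)]
  -- The bound comes from the first-order estimate: `c · 2 (η² / (cG)) · M₂` does not depend on `c`.
  refine tendsto_integral_filter_of_dominated_convergence (fun v => 2 * M₂ / G * η v ^ 2) ?_ ?_
    (hη2.const_mul _) ?_
  · refine Eventually.of_forall fun c => ?_
    have hψm : Measurable fun z : ℝ × ℝ =>
        Complex.exp ((η z.1 / √(c * G) * z.2 : ℝ) * Complex.I) := by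
      have : Measurable fun z : ℝ × ℝ => η z.1 / √(c * G) * z.2 :=
        ((hη.comp measurable_fst).div_const _).mul measurable_snd
      exact Complex.measurable_exp.comp ((Complex.measurable_ofReal.comp this).mul_const _)
    have : StronglyMeasurable fun v =>
        ∫ x, Complex.exp ((η v / √(c * G) * x : ℝ) * Complex.I) ∂(F (c * v)) :=
      hψm.stronglyMeasurable.integral_kernel_prod_right'
        (κ := F.comap (fun v => c * v) (measurable_const_mul c))
    exact ((this.measurable.sub_const 1).const_mul _).aestronglyMeasurable
  · filter_upwards [eventually_gt_atTop 0] with c hc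
    refine (ae_restrict_iff' measurableSet_Ioi).2 (ae_of_all _ fun v hv => ?_)
    have hcv : 0 < c * v := mul_pos hc hv
    have h := norm_integral_cexp_sub_one_le (h1 _ hcv) (hm _ hcv) (h2 _ hcv) (η v / √(c * G))
    rw [norm_mul, Complex.norm_real, Real.norm_of_nonneg hc.le]
    have h5 : ∫ x, x ^ 2 ∂(F (c * v)) ≤ M₂ := hK2 _ hcv
    calc _ ≤ c * (2 * (η v / √(c * G)) ^ 2 * M₂) :=
          mul_le_mul_of_nonneg_left (h.trans (by gcongr)) hc.le
      _ = _ := by rw [hsq hc]; field_simp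
  · refine (ae_restrict_iff' measurableSet_Ioi).2 (ae_of_all _ fun v hv => ?_)
    have hv : 0 < v := hv
    have hlim2 : Tendsto (fun c : ℝ => condMoment F 2 (c * v)) atTop (𝓝 K) :=
      hK2lim.comp (tendsto_id.atTop_mul_const hv)
    have hmain : Tendsto (fun c : ℝ => ((-(η v ^ 2 * condMoment F 2 (c * v) / (2 * G)) : ℝ) : ℂ))
        atTop (𝓝 ((-(η v ^ 2 * K / (2 * G)) : ℝ) : ℂ)) :=
      (Complex.continuous_ofReal.tendsto _).comp ((hlim2.const_mul _).div_const _).neg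
    refine hmain.congr_dist ?_
    -- The Taylor remainder is of order `c · (cG)^(-3/2)`, that is `c^(-1/2)`.
    have hz : Tendsto (fun c : ℝ => 3 * |η v| ^ 3 / (G * √G) * (M₂ + M₄) * (√c)⁻¹) atTop (𝓝 0) := by
      simpa using (Real.tendsto_sqrt_atTop.inv_tendsto_atTop).const_mul
        (3 * |η v| ^ 3 / (G * √G) * (M₂ + M₄))
    refine squeeze_zero' (Eventually.of_forall fun c => dist_nonneg) ?_ hz
    filter_upwards [eventually_gt_atTop 0] with c hc
    have hcv : 0 < c * v := mul_pos hc hv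
    have h := norm_integral_cexp_sub_one_add_le (h1 _ hcv) (hm _ hcv) (h2 _ hcv) (h4 _ hcv)
      (η v / √(c * G))
    have h5 : ∫ x, x ^ 2 ∂(F (c * v)) + ∫ x, x ^ 4 ∂(F (c * v)) ≤ M₂ + M₄ :=
      add_le_add (hK2 _ hcv) (hK4 _ hcv)
    rw [dist_comm, dist_eq_norm]
    have hEq : c * (∫ x, Complex.exp ((η v / √(c * G) * x : ℝ) * Complex.I) ∂(F (c * v)) - 1) -
        ((-(η v ^ 2 * condMoment F 2 (c * v) / (2 * G)) : ℝ) : ℂ) =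
        c * (∫ x, Complex.exp ((η v / √(c * G) * x : ℝ) * Complex.I) ∂(F (c * v)) - 1 +
          ((η v / √(c * G)) ^ 2 / 2 * ∫ x, x ^ 2 ∂(F (c * v)) : ℝ)) := by
      have : -(η v ^ 2 * condMoment F 2 (c * v) / (2 * G)) =
          -(c * ((η v / √(c * G)) ^ 2 / 2 * ∫ x, x ^ 2 ∂(F (c * v)))) := by
        rw [hsq hc, condMoment]; field_simp
      rw [this]; push_cast; ring
    rw [hEq, norm_mul, Complex.norm_real, Real.norm_of_nonneg hc.le]
    calc _ ≤ c * (3 * |η v / √(c * G)| ^ 3 * (M₂ + M₄)) :=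
          mul_le_mul_of_nonneg_left (h.trans (by gcongr)) hc.le
      _ = _ := by
        rw [abs_div, abs_of_nonneg (Real.sqrt_nonneg _), Real.sqrt_mul hc.le, div_pow, mul_pow]
        have hsc : 0 < √c := Real.sqrt_pos.2 hc
        have hsG : 0 < √G := Real.sqrt_pos.2 hG
        have e1 : c = √c ^ 2 := (Real.sq_sqrt hc.le).symm
        have e2 : G = √G ^ 2 := (Real.sq_sqrt hG.le).symm
        generalize √c = p at *
        generalize √G = q at *
        subst e1 e2
        field_simp

end Limit

/-! ### Lévy continuity and the Cramér–Wold device -/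

section Distribution

variable {Ω Ω' : Type*} [MeasurableSpace Ω] [MeasurableSpace Ω'] {P : Measure Ω}
  {P' : Measure Ω'} {ι : Type*} [Fintype ι]

lemma charFun_map_toLp {X : Ω → ι → ℝ} (hX : AEMeasurable X P) (a : EuclideanSpace ℝ ι) :
    charFun (P.map fun ω => WithLp.toLp 2 (X ω)) a =
      ∫ ω, Complex.exp ((∑ i, a i * X ω i : ℝ) * Complex.I) ∂P := by
  rw [charFun_apply, integral_map (by fun_prop) (by fun_prop)]
  rfl

/-- **Cramér–Wold device** for families indexed by the real numbers. -/
lemma tendstoInDistribution_of_tendsto_integral_cexp [IsProbabilityMeasure P]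
    [IsProbabilityMeasure P'] {X : ℝ → Ω → ι → ℝ} {Z : Ω' → ι → ℝ}
    (hX : ∀ c, AEMeasurable (X c) P) (hZ : AEMeasurable Z P')
    (h : ∀ a : ι → ℝ, Tendsto
      (fun c => ∫ ω, Complex.exp ((∑ i, a i * X c ω i : ℝ) * Complex.I) ∂P) atTop
      (𝓝 (∫ ω, Complex.exp ((∑ i, a i * Z ω i : ℝ) * Complex.I) ∂P'))) :
    TendstoInDistribution X atTop Z (fun _ => P) P' := by
  -- Characteristic functions use an inner product, hence the detour through `EuclideanSpace`; the
  -- return map is continuous. Lévy's theorem is applied along sequences `c → ∞`.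
  have hE : TendstoInDistribution (fun c ω => (WithLp.toLp 2 (X c ω) : EuclideanSpace ℝ ι)) atTop
      (fun ω => (WithLp.toLp 2 (Z ω) : EuclideanSpace ℝ ι)) (fun _ => P) P' := by
    refine ⟨fun c => by have := hX c; fun_prop, by fun_prop, ?_⟩
    refine tendsto_of_seq_tendsto fun u hu => ?_
    refine ProbabilityMeasure.tendsto_iff_tendsto_charFun.2 fun a => ?_
    simp only [ProbabilityMeasure.coe_mk, Function.comp]
    rw [charFun_map_toLp hZ]
    simp_rw [fun n => charFun_map_toLp (hX (u n)) a]
    exact (h a).comp hu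
  exact hE.continuous_comp (g := fun x => WithLp.ofLp x) (by fun_prop)

end Distribution

/-! ### Convergence of the finite-dimensional distributions -/

section FDD

variable {Ω Ω' : Type*} [MeasurableSpace Ω] [MeasurableSpace Ω'] {P : Measure Ω}
  [IsProbabilityMeasure P] {P' : Measure Ω'} {α r K : ℝ} {I : Finset ℝ≥0}

/-- A linear combination of a Gaussian process is a centred real Gaussian whose variance is the
quadratic form; its characteristic function is taken at `1`. -/
lemma IsHadamardFBM.integral_cexp_sum {B : ℝ≥0 → Ω' → ℝ} (hB : IsHadamardFBM α P' B)
    (a : I → ℝ) :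
    ∫ ω, Complex.exp ((∑ t : I, a t * B t ω : ℝ) * Complex.I) ∂P' =
      Complex.exp ((-(∑ s : I, ∑ t : I, a s * a t * hadamardCov α s t) / 2 : ℝ)) := by
  have := hB.isGaussianProcess.isProbabilityMeasure
  have hmem : ∀ t : I, MemLp (fun ω => a t * B t ω) 2 P' := fun t =>
    (hB.isGaussianProcess.hasGaussianLaw_eval t).memLp_two.const_mul (a t)
  have hlaw : HasGaussianLaw (fun ω => ∑ t : I, a t * B t ω) P' := by
    have h := (hB.isGaussianProcess.hasGaussianLaw I).map_fun
      (∑ t : I, a t • ContinuousLinearMap.proj (R := ℝ) (φ := fun _ : I => ℝ) t)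
    simpa using h
  have hmean : ∫ ω, ∑ t : I, a t * B t ω ∂P' = 0 := by
    rw [integral_finsetSum _ fun t _ => (hmem t).integrable (by norm_num)]
    simp [integral_const_mul, hB.mean_zero]
  have hvar : Var[fun ω => ∑ t : I, a t * B t ω; P'] =
      ∑ s : I, ∑ t : I, a s * a t * hadamardCov α s t := by
    rw [← covariance_self hlaw.aemeasurable, covariance_fun_sum_fun_sum hmem hmem]
    refine Finset.sum_congr rfl fun s _ => Finset.sum_congr rfl fun t _ => ?_
    rw [covariance_const_mul_left, covariance_const_mul_right, hB.covariance_eq]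
    ring
  have hc : charFun (P'.map fun ω => ∑ t : I, a t * B t ω) 1 =
      ∫ ω, Complex.exp ((∑ t : I, a t * B t ω : ℝ) * Complex.I) ∂P' := by
    rw [charFun_apply_real, integral_map hlaw.aemeasurable (by fun_prop)]
    simp
  rw [← hc, hlaw.map_eq_gaussianReal, charFun_gaussianReal, hmean, ← hvar,
    Real.coe_toNNReal _ (variance_nonneg _ _)]
  congr 1
  push_cast; ring

/-- The finite-dimensional distributions of the scaled shot noise converge to those of Hadamard
fractional Brownian motion. -/
theorem IsHadamardFBM.tendstoFDD [IsProbabilityMeasure P'] {B : ℝ≥0 → Ω' → ℝ}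
    (hB : IsHadamardFBM α P' B) (hα : 1 < α ∧ α < 2) (hr : 0 < r) {T R : ℕ → Ω → ℝ}
    {F : Kernel ℝ ℝ} [IsMarkovKernel F] (hT : IsPoissonEpochs r T P)
    (hR : IsNoiseGivenEpochs F T R P)
    (hfin : ∀ m ∈ Finset.Icc 1 4, ∀ u : ℝ, 0 < u → Integrable (fun x : ℝ => x ^ m) (F u))
    (hK1 : ∀ u : ℝ, 0 < u → condMoment F 1 u = 0)
    (hK2bdd : ∃ M : ℝ, ∀ u : ℝ, 0 < u → condMoment F 2 u ≤ M)
    (hK4bdd : ∃ M : ℝ, ∀ u : ℝ, 0 < u → condMoment F 4 u ≤ M)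
    (hK : 0 < K) (hK2lim : Tendsto (condMoment F 2) atTop (𝓝 K)) :
    TendstoFDD (scaledShotNoise α r K T R) P B P' := by
  intro I
  obtain ⟨M₂, hM₂⟩ := hK2bdd
  obtain ⟨M₄, hM₄⟩ := hK4bdd
  have hβ : 0 < (α - 1) / 2 := by linarith [hα.1]
  have hΓ : 0 < Real.Gamma α := Real.Gamma_pos_of_pos (by linarith [hα.1])
  have hG : 0 < K * r * Real.Gamma α := by positivity
  refine tendstoInDistribution_of_tendsto_integral_cexp
    (fun c => aemeasurable_pi_lambda _ fun t =>
      hT.aemeasurable_scaledShotNoise hr hR.measurable hα.1 c t)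
    (aemeasurable_pi_lambda _ fun t => hB.isGaussianProcess.aemeasurable t) fun a => ?_
  rw [hB.integral_cexp_sum a]
  have hlim := tendsto_integral_scaled_charFun_sub_one (measurable_responseSum ((α - 1) / 2) a)
    (integrableOn_responseSum_sq hβ a) hG hfin hK1 hM₂ hM₄ hK2lim
  -- The factor `K r Γ(α)` in the scaling cancels `K` from the noise and `Γ(α)` from the inner
  -- product; the remaining `1 / r` cancels the intensity.
  have hval : ∫ v in Set.Ioi (0 : ℝ), ((-(responseSum ((α - 1) / 2) a v ^ 2 * K /
      (2 * (K * r * Real.Gamma α))) : ℝ) : ℂ) =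
      ((-(∑ s : I, ∑ t : I, a s * a t * hadamardCov α s t) / 2 / r : ℝ) : ℂ) := by
    rw [integral_complex_ofReal, integral_neg, integral_div, integral_mul_const,
      integral_responseSum_sq hα]
    congr 1
    field_simp
  rw [hval] at hlim
  have h := (Complex.continuous_exp.tendsto _).comp (hlim.const_mul (r : ℂ))
  rw [← Complex.ofReal_mul, mul_div_cancel₀ _ hr.ne'] at h
  refine h.congr' ?_
  filter_upwards [eventually_gt_atTop 0] with c hc
  exact (hR.integral_cexp_sum_scaledShotNoise hT hr hα.1 hc a).symm

end FDD

end HadamardShotNoise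

theorem theorem3p1 {Ω : Type*} [MeasurableSpace Ω] (P : Measure Ω) [IsProbabilityMeasure P]
    (α : ℝ) (hα : 1 < α ∧ α < 2) (r : ℝ) (hr : 0 < r)
    (T R : ℕ → Ω → ℝ) (F : Kernel ℝ ℝ) [IsMarkovKernel F]
    (hT : HadamardShotNoise.IsPoissonEpochs r T P)
    (hR : HadamardShotNoise.IsNoiseGivenEpochs F T R P)
    (hfin : ∀ m ∈ Finset.Icc 1 4, ∀ u : ℝ, 0 < u → Integrable (fun x : ℝ => x ^ m) (F u))
    (hK1 : ∀ u : ℝ, 0 < u → HadamardShotNoise.condMoment F 1 u = 0)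
    (hK2pos : ∀ u : ℝ, 0 < u → 0 < HadamardShotNoise.condMoment F 2 u)
    (hK4pos : ∀ u : ℝ, 0 < u → 0 < HadamardShotNoise.condMoment F 4 u)
    (hK2bdd : ∃ M : ℝ, ∀ u : ℝ, 0 < u → HadamardShotNoise.condMoment F 2 u ≤ M)
    (hK4bdd : ∃ M : ℝ, ∀ u : ℝ, 0 < u → HadamardShotNoise.condMoment F 4 u ≤ M)
    (K : ℝ) (hK : 0 < K)
    (hK2lim : Tendsto (HadamardShotNoise.condMoment F 2) atTop (𝓝 K))
    (κ : ℝ) (hκ : 0 < κ)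
    (hK42 : ∀ u : ℝ, 0 < u →
      HadamardShotNoise.condMoment F 4 u / HadamardShotNoise.condMoment F 2 u ≤ κ) :
    (∃ (Ω₀ : Type) (_ : MeasurableSpace Ω₀) (P₀ : Measure Ω₀) (B₀ : ℝ≥0 → Ω₀ → ℝ),
      HadamardShotNoise.IsHadamardFBM α P₀ B₀) ∧
    ∀ (Ω' : Type*) [MeasurableSpace Ω'] (P' : Measure Ω') [IsProbabilityMeasure P']
      (B : ℝ≥0 → Ω' → ℝ), HadamardShotNoise.IsHadamardFBM α P' B →
      HadamardShotNoise.TendstoFDD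
        (HadamardShotNoise.scaledShotNoise α r K T R) P B P' := by
  refine ⟨HadamardShotNoise.exists_isHadamardFBM hα, fun Ω' _ P' _ B hB => ?_⟩
  exact hB.tendstoFDD hα hr hT hR hfin hK1 hK2bdd hK4bdd hK hK2lim
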